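/- Let $\Omega\subset\mathbb R^3$ be a bounded domain (nonempty, open, connected) with $C^\infty$ boundary $S=\partial\Omega$, lying locally on one side of $S$, with outward unit normal $\mathbf n$ and surface measure $dS$, and let $f:S\to\mathbb R$ be of class $C^2$. Put $G(\mathbf z)=-\frac1{4\pi|\mathbf z|}$ and, for $\delta>0$, $G_\delta(\mathbf z)=G(\mathbf z)\,\mathrm{erf}(|\mathbf z|/\delta)$, where $\mathrm{erf}(\rho)=\frac2{\sqrt\pi}\int_0^\rho e^{-t^2}\,dt$, and let $s(\rho)=\mathrm{erf}(\rho)-\frac2{\sqrt\pi}\rho e^{-\rho^2}$. For $\mathbf y\in S$ define the modified adjoint double layer and its regularization $$v(\mathbf y)=\int_S\frac{(f(\mathbf x)\mathbf n(\mathbf y)+f(\mathbf y)\mathbf n(\mathbf x))\cdot(\mathbf y-\mathbf x)}{4\pi|\mathbf x-\mathbf y|^3}\,dS(\mathbf x)+\tfrac12f(\mathbf y),$$ $$v_\delta(\mathbf y)=\int_S\frac{(f(\mathbf x)\mathbf n(\mathbf y)+f(\mathbf y)\mathbf n(\mathbf x))\cdot(\mathbf y-\mathbf x)\,s(|\mathbf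 x-\mathbf y|/\delta)}{4\pi|\mathbf x-\mathbf y|^3}\,dS(\mathbf x)+\tfrac12f(\mathbf y),$$ and the errors of the two parts of the potential $$\epsilon_\delta(\mathbf y)=\int_S f(\mathbf x)\,[\nabla G_\delta(\mathbf x-\mathbf y)-\nabla G(\mathbf x-\mathbf y)]\cdot(\mathbf n(\mathbf y)+\mathbf n(\mathbf x))\,dS(\mathbf x),$$ $$\eta_\delta(\mathbf y)=\int_S (f(\mathbf x)-f(\mathbf y))\,[\nabla G_\delta(\mathbf x-\mathbf y)-\nabla G(\mathbf x-\mathbf y)]\cdot\mathbf n(\mathbf x)\,dS(\mathbf x).$$ Then: 1. For all $\mathbf z\ne0$ and $\delta>0$: $\nabla G(\mathbf z)=\frac{\mathbf z}{4\pi|\mathbf z|^3}$ and $\nabla G_\delta(\mathbf z)=s(|\mathbf z|/\delta)\,\nabla G(\mathbf z)$; that is, replacing $G$ by $G_\delta$ multiplies $\nabla G$ by the shape factor $s$. 2. For all $\mathbf y\in S$ and $\delta>0$ the four integrals above converge absolutely. 3. The regularization error is $O(\delta^3)$ on the surface: there is a constant $C$, depending only on $\Omega$ and $f$, such that for all $\delta>0$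 and all $\mathbf y\in S$ $$|\epsilon_\delta(\mathbf y)|\le C\delta^3,\qquad |\eta_\delta(\mathbf y)|\le C\delta^3,\qquad |v_\delta(\mathbf y)-v(\mathbf y)|\le C\delta^3 .$$ -/

import Mathlib

open scoped ContDiff MeasureTheory Gradient

namespace ADL

noncomputable section

/-- Three-dimensional Euclidean space. -/
abbrev E3 : Type := EuclideanSpace ℝ (Fin 3)

/-- `ρ` is a smooth local defining function of `Ω` on the open set `U`: its gradient does not
vanish on `U`, and inside `U` the set `Ω` is exactly the set where `ρ` is negative. -/
structure IsLocalDefiningFunction (Ω U : Set E3) (ρ : E3 → ℝ) : Prop where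
  isOpen : IsOpen U
  contDiffOn : ContDiffOn ℝ ∞ ρ U
  gradient_ne_zero : ∀ x ∈ U, ∇ ρ x ≠ 0
  inter_eq : Ω ∩ U = {x ∈ U | ρ x < 0}

/-- A bounded domain (nonempty, open, connected) whose boundary is a smooth surface with the
domain locally on one side of it. -/
structure IsBoundedSmoothDomain (Ω : Set E3) : Prop where
  isOpen : IsOpen Ω
  isConnected : IsConnected Ω
  isBounded : Bornology.IsBounded Ω
  smooth_boundary : ∀ p ∈ frontier Ω, ∃ U ρ, IsLocalDefiningFunction Ω U ρ ∧ p ∈ U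

/-- `ν` is the outward unit normal at the boundary point `p`: the normalized gradient of a local
defining function (it points in the direction in which the defining function increases). -/
def IsOutwardUnitNormalAt (Ω : Set E3) (p ν : E3) : Prop :=
  p ∈ frontier Ω ∧ ∃ U ρ, IsLocalDefiningFunction Ω U ρ ∧ p ∈ U ∧ ν = ‖∇ ρ p‖⁻¹ • ∇ ρ p

open Classical in
/-- The outward unit normal field on the boundary of `Ω` (zero where there is none). It does not
depend on the defining function that is chosen, see `outwardNormal_eq`. -/
def outwardNormal (Ω : Set E3) (p : E3) : E3 :=
  if h : ∃ ν, IsOutwardUnitNormalAt Ω p ν then h.choose else 0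

/-- A local defining function vanishes at the boundary points of `Ω`. -/
theorem IsLocalDefiningFunction.eq_zero {Ω U : Set E3} {ρ : E3 → ℝ} {p : E3}
    (hΩ : IsOpen Ω) (h : IsLocalDefiningFunction Ω U ρ) (hp : p ∈ frontier Ω) (hU : p ∈ U) :
    ρ p = 0 := by
  have hcont : ContinuousAt ρ p :=
    (h.contDiffOn.continuousOn p hU).continuousAt (h.isOpen.mem_nhds hU)
  rw [hΩ.frontier_eq] at hp
  apply le_antisymm
  · by_contra hlt
    push Not at hlt
    have hev : ∀ᶠ x in nhds p, 0 < ρ x ∧ x ∈ U :=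
      (hcont.eventually (lt_mem_nhds hlt)).and (h.isOpen.mem_nhds hU)
    obtain ⟨x, ⟨hx0, hxU⟩, hxΩ⟩ := mem_closure_iff_nhds.1 hp.1 _ hev
    have hx : x ∈ Ω ∩ U := ⟨hxΩ, hxU⟩
    rw [h.inter_eq] at hx
    exact absurd hx.2 (not_lt.2 hx0.le)
  · by_contra hlt
    push Not at hlt
    have hx : p ∈ {x ∈ U | ρ x < 0} := ⟨hU, hlt⟩
    rw [← h.inter_eq] at hx
    exact hp.2 hx.1

/-- A direction of decrease of one local defining function is not one of increase of another. -/
theorem IsLocalDefiningFunction.inner_nonpos {Ω U₁ U₂ : Set E3} {ρ₁ ρ₂ : E3 → ℝ} {p v : E3}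
    (hΩ : IsOpen Ω) (h₁ : IsLocalDefiningFunction Ω U₁ ρ₁) (h₂ : IsLocalDefiningFunction Ω U₂ ρ₂)
    (hp : p ∈ frontier Ω) (hU₁ : p ∈ U₁) (hU₂ : p ∈ U₂) (hv : inner ℝ (∇ ρ₁ p) v < 0) :
    inner ℝ (∇ ρ₂ p) v ≤ 0 := by
  have key : ∀ {U : Set E3} {ρ : E3 → ℝ}, IsLocalDefiningFunction Ω U ρ → p ∈ U →
      HasDerivAt (fun t : ℝ => ρ (p + t • v)) (inner ℝ (∇ ρ p) v) 0 := by
    intro U ρ h hU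
    have hd : DifferentiableAt ℝ ρ p :=
      ((h.contDiffOn.contDiffAt (h.isOpen.mem_nhds hU)).differentiableAt (by simp))
    have hg := hd.hasGradientAt.hasFDerivAt
    have hl : HasDerivAt (fun t : ℝ => p + t • v) v 0 := by
      simpa using ((hasDerivAt_id (0 : ℝ)).smul_const v).const_add p
    have hg' : HasFDerivAt ρ (InnerProductSpace.toDual ℝ E3 (∇ ρ p)) (p + (0 : ℝ) • v) := by
      simpa using hg
    have hc := hg'.comp_hasDerivAt (0 : ℝ) hl
    rw [InnerProductSpace.toDual_apply_apply] at hc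
    exact hc
  have d₁ := key h₁ hU₁
  have d₂ := key h₂ hU₂
  have hmem : ∀ {U : Set E3}, IsOpen U → p ∈ U → ∀ᶠ t : ℝ in nhds 0, p + t • v ∈ U := by
    intro U hU hpU
    have hc : ContinuousAt (fun t : ℝ => p + t • v) 0 := by fun_prop
    exact hc.eventually (by simpa using hU.mem_nhds hpU)
  have h0 : ρ₁ p = 0 := h₁.eq_zero hΩ hp hU₁
  have h0' : ρ₂ p = 0 := h₂.eq_zero hΩ hp hU₂
  by_contra hcon
  push Not at hcon
  have t₁ := d₁.tendsto_slope_zero_right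
  have t₂ := d₂.tendsto_slope_zero_right
  have m₁ := (hmem h₁.isOpen hU₁).filter_mono (nhdsWithin_le_nhds (s := Set.Ioi (0 : ℝ)))
  have m₂ := (hmem h₂.isOpen hU₂).filter_mono (nhdsWithin_le_nhds (s := Set.Ioi (0 : ℝ)))
  obtain ⟨t, ⟨⟨⟨e₁, e₂⟩, e₃⟩, e₄⟩, e₅⟩ :=
    (((((t₁.eventually (gt_mem_nhds hv)).and (t₂.eventually (lt_mem_nhds hcon))).and m₁).and
      m₂).and (self_mem_nhdsWithin (s := Set.Ioi (0 : ℝ)))).exists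
  have ht : (0 : ℝ) < t := e₅
  simp only [zero_add, zero_smul, add_zero, h0, h0', sub_zero, smul_eq_mul] at e₁ e₂
  have n₁ : ρ₁ (p + t • v) < 0 := by
    by_contra hge
    push Not at hge
    exact absurd e₁ (not_lt.2 (mul_nonneg (inv_nonneg.2 ht.le) hge))
  have n₂ : 0 < ρ₂ (p + t • v) := by
    by_contra hle
    push Not at hle
    exact absurd e₂ (not_lt.2 (mul_nonpos_of_nonneg_of_nonpos (inv_nonneg.2 ht.le) hle))
  have hx : p + t • v ∈ Ω ∩ U₁ := by
    rw [h₁.inter_eq]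
    exact ⟨e₃, n₁⟩
  have hy : p + t • v ∈ Ω ∩ U₂ := ⟨hx.1, e₄⟩
  rw [h₂.inter_eq] at hy
  exact absurd hy.2 (not_lt.2 n₂.le)

/-- The outward unit normal is unique. -/
theorem IsOutwardUnitNormalAt.unique {Ω : Set E3} {p ν₁ ν₂ : E3} (hΩ : IsOpen Ω)
    (h₁ : IsOutwardUnitNormalAt Ω p ν₁) (h₂ : IsOutwardUnitNormalAt Ω p ν₂) : ν₁ = ν₂ := by
  obtain ⟨hp, U₁, ρ₁, d₁, m₁, rfl⟩ := h₁
  obtain ⟨-, U₂, ρ₂, d₂, m₂, rfl⟩ := h₂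
  have g₁ := d₁.gradient_ne_zero p m₁
  have g₂ := d₂.gradient_ne_zero p m₂
  set a := ∇ ρ₁ p with ha
  set b := ∇ ρ₂ p with hb
  have pa : 0 < ‖a‖ := norm_pos_iff.2 g₁
  have pb : 0 < ‖b‖ := norm_pos_iff.2 g₂
  have na : ‖‖a‖⁻¹ • a‖ = 1 := norm_smul_inv_norm (𝕜 := ℝ) g₁
  have nb : ‖‖b‖⁻¹ • b‖ = 1 := norm_smul_inv_norm (𝕜 := ℝ) g₂
  by_contra hne
  have hlt := (inner_lt_one_iff_real_of_norm_eq_one na nb).2 hne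
  have hav : inner ℝ a (‖b‖⁻¹ • b - ‖a‖⁻¹ • a) < 0 := by
    have e : inner ℝ a (‖b‖⁻¹ • b - ‖a‖⁻¹ • a)
        = ‖a‖ * (inner ℝ (‖a‖⁻¹ • a) (‖b‖⁻¹ • b) - inner ℝ (‖a‖⁻¹ • a) (‖a‖⁻¹ • a)) := by
      rw [← inner_sub_right, real_inner_smul_left, ← mul_assoc, mul_inv_cancel₀ pa.ne', one_mul]
    rw [e, real_inner_self_eq_norm_sq, na]
    exact mul_neg_of_pos_of_neg pa (by linarith)
  have hbv : 0 < inner ℝ b (‖b‖⁻¹ • b - ‖a‖⁻¹ • a) := by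
    have e : inner ℝ b (‖b‖⁻¹ • b - ‖a‖⁻¹ • a)
        = ‖b‖ * (inner ℝ (‖b‖⁻¹ • b) (‖b‖⁻¹ • b) - inner ℝ (‖b‖⁻¹ • b) (‖a‖⁻¹ • a)) := by
      rw [← inner_sub_right, real_inner_smul_left, ← mul_assoc, mul_inv_cancel₀ pb.ne', one_mul]
    rw [e, real_inner_self_eq_norm_sq, nb, real_inner_comm]
    exact mul_pos pb (by linarith)
  exact absurd (d₁.inner_nonpos hΩ d₂ hp m₁ m₂ hav) (not_le.2 hbv)

/-- The outward unit normal is the normalized gradient of any local defining function. -/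
theorem outwardNormal_eq {Ω U : Set E3} {ρ : E3 → ℝ} {p : E3} (hΩ : IsOpen Ω)
    (h : IsLocalDefiningFunction Ω U ρ) (hp : p ∈ frontier Ω) (hU : p ∈ U) :
    outwardNormal Ω p = ‖∇ ρ p‖⁻¹ • ∇ ρ p := by
  have hν : IsOutwardUnitNormalAt Ω p (‖∇ ρ p‖⁻¹ • ∇ ρ p) := ⟨hp, U, ρ, h, hU, rfl⟩
  have hex : ∃ ν, IsOutwardUnitNormalAt Ω p ν := ⟨_, hν⟩
  rw [outwardNormal, dif_pos hex]
  exact hex.choose_spec.unique hΩ hν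

/-- The error function. -/
def erf (t : ℝ) : ℝ := 2 / √Real.pi * ∫ u in (0 : ℝ)..t, Real.exp (-u ^ 2)

/-- The shape factor `s`. -/
def shapeFactor (t : ℝ) : ℝ := erf t - 2 / √Real.pi * t * Real.exp (-t ^ 2)

/-- The Green's function `G` of Laplace's equation. -/
def green (z : E3) : ℝ := -1 / (4 * Real.pi * ‖z‖)

/-- The regularized Green's function `G_δ`. -/
def greenReg (δ : ℝ) (z : E3) : ℝ := green z * erf (‖z‖ / δ)

/-- The surface integral over the boundary of `Ω`; the area measure is the two-dimensional
Hausdorff measure, normalized so that it is Lebesgue measure on planes. -/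
def surfaceIntegral (Ω : Set E3) (F : E3 → ℝ) : ℝ := ∫ x in frontier Ω, F x ∂μHE[2]

/-- Integrability over the boundary of `Ω`. -/
def SurfaceIntegrable (Ω : Set E3) (F : E3 → ℝ) : Prop :=
  MeasureTheory.IntegrableOn F (frontier Ω) μHE[2]

/-- The integrand of the modified adjoint double layer at `y`, as a function of `x`. -/
def modifiedIntegrand (Ω : Set E3) (f : E3 → ℝ) (y x : E3) : ℝ :=
  inner ℝ (f x • outwardNormal Ω y + f y • outwardNormal Ω x) (y - x) / (4 * Real.pi * ‖x - y‖ ^ 3)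

/-- The modified adjoint double layer `v`. -/
def modifiedADL (Ω : Set E3) (f : E3 → ℝ) (y : E3) : ℝ :=
  surfaceIntegral Ω (modifiedIntegrand Ω f y) + 1 / 2 * f y

/-- The integrand of the regularized modified adjoint double layer. -/
def regularizedIntegrand (Ω : Set E3) (δ : ℝ) (f : E3 → ℝ) (y x : E3) : ℝ :=
  inner ℝ (f x • outwardNormal Ω y + f y • outwardNormal Ω x) (y - x) *
    shapeFactor (‖x - y‖ / δ) / (4 * Real.pi * ‖x - y‖ ^ 3)

/-- The regularized modified adjoint double layer `v_δ`. -/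
def regularizedADL (Ω : Set E3) (δ : ℝ) (f : E3 → ℝ) (y : E3) : ℝ :=
  surfaceIntegral Ω (regularizedIntegrand Ω δ f y) + 1 / 2 * f y

/-- The integrand of the error `ε` in the first part of the potential (the part with the sum of
the two normals): `f(x) [∇G_δ(x - y) - ∇G(x - y)] · (n(y) + n(x))`. -/
def normalSumErrorIntegrand (Ω : Set E3) (δ : ℝ) (f : E3 → ℝ) (y x : E3) : ℝ :=
  f x * inner ℝ (∇ (greenReg δ) (x - y) - ∇ green (x - y)) (outwardNormal Ω y + outwardNormal Ω x)

/-- The integrand of the error in the second part of the potential, the subtracted double layer: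
`(f(x) - f(y)) [∇G_δ(x - y) - ∇G(x - y)] · n(x)`. -/
def doubleLayerErrorIntegrand (Ω : Set E3) (δ : ℝ) (f : E3 → ℝ) (y x : E3) : ℝ :=
  (f x - f y) * inner ℝ (∇ (greenReg δ) (x - y) - ∇ green (x - y)) (outwardNormal Ω x)

end

end ADL

open ADL

/-! Both errors involve only the vector `∇ (greenReg δ) z - ∇ green z = errorKernel δ ‖z‖ • z`,
where `errorKernel δ r = (s(r/δ) - 1) / (4πr³)`. The factor `s - 1` is bounded and decays rapidly
once `r` exceeds `δ`, so at a fixed distance from `y` the kernel is `O(δ³)` and only a neighbourhood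
of `y` matters. There size alone is not enough: a density of order `|w|²` in the plane would give
`O(δ)`, one of order `|w|³` only `O(δ²)`. The remaining powers come from cancellation.

Near a boundary point, let `S` be the graph of `h` over a plane and let `w` be the displacement of
the parameter from that of `y`. Up to area factors, `(x - y) · n(x)` is `sourceDefect = -D²h(w,w)/2
+ ...` and `(x - y) · n(y)` is `targetDefect = D²h(w,w)/2 + ...`. Their sum, which enters `ε`, loses
the quadratic part and begins with an odd cubic term. In `η`, the odd linear part of `f(x) - f(y)`
multiplies the even quadratic part of `sourceDefect`. Hence both densities are cubic and odd up to
`O(|w|⁴)` (`exists_hasParity_densities`).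

Pair `w` with `-w`. The densities cancel up to `O(|w|⁴)`, and the two distances to `y` differ by
`O(|w|²)` (`abs_graphDist_sub_le`), which the slope bound of the kernel turns into the same order.
The paired integrand is `O(|w| / (1 + |w|/δ)⁴)`, and scaling `w` by `δ` in the plane gives `δ³`
(`exists_integral_errorKernel_bound`).

The chart constants are uniform for `y` near a point, so compactness of `S` gives one constant. The
error of the modified layer is exactly `η - ε`. The area formula for graphs converts Hausdorff
integrals into plane integrals. -/

namespace ADL

open MeasureTheory Measure Module Set Filter Topology
open scoped NNReal ENNReal

/-! ### Area formula for the Hausdorff measure. -/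

section AreaFormula

/-- On `s` the map `f` factors through `g` by a `k`-Lipschitz map: points with equal `g` values have
equal `f` values. This compares two images of one parameter set, such as a nonlinear image and its
linearization. -/
theorem euclideanHausdorffMeasure_image_le_of_dist_le {X Y Z : Type*} [MetricSpace Y]
    [MeasurableSpace Y] [BorelSpace Y] [MetricSpace Z] [MeasurableSpace Z] [BorelSpace Z]
    {f : X → Y} {g : X → Z} {s : Set X} {k : ℝ≥0} (d : ℕ)
    (h : ∀ x ∈ s, ∀ y ∈ s, dist (f x) (f y) ≤ k * dist (g x) (g y)) :
    μHE[d] (f '' s) ≤ (k : ℝ≥0∞) ^ d * μHE[d] (g '' s) := by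
  classical
  rcases s.eq_empty_or_nonempty with rfl | ⟨x₀, hx₀⟩
  · simp
  have : Nonempty X := ⟨x₀⟩
  set ψ : Z → Y := fun z => f (Function.invFunOn g s z) with hψ
  have hinv : ∀ x ∈ s, ψ (g x) = f x := by
    intro x hx
    have hm := Function.invFunOn_mem (f := g) (s := s) (b := g x) ⟨x, hx, rfl⟩
    have he := Function.invFunOn_eq (f := g) (s := s) (b := g x) ⟨x, hx, rfl⟩
    have := h _ hm x hx
    rw [he, dist_self, mul_zero] at this
    exact dist_le_zero.1 this
  have hl : LipschitzOnWith k ψ (g '' s) := by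
    refine LipschitzOnWith.of_dist_le_mul ?_
    rintro _ ⟨x, hx, rfl⟩ _ ⟨y, hy, rfl⟩
    rw [hinv x hx, hinv y hy]
    exact h x hx y hy
  have himg : f '' s = ψ '' (g '' s) := by
    rw [image_image]
    exact image_congr fun x hx => (hinv x hx).symm
  have := hl.hausdorffMeasure_image_le (d := d) (by positivity)
  rw [himg, euclideanHausdorffMeasure_def, euclideanHausdorffMeasure_def, Measure.smul_apply,
    Measure.smul_apply, ENNReal.smul_def, ENNReal.smul_def, smul_eq_mul, smul_eq_mul, mul_left_comm]
  gcongr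
  simpa using this

variable {U V : Type*} [NormedAddCommGroup U] [InnerProductSpace ℝ U] [FiniteDimensional ℝ U]
  [MeasurableSpace U] [BorelSpace U]
  [NormedAddCommGroup V] [InnerProductSpace ℝ V] [MeasurableSpace V] [BorelSpace V]

/-- Since `A` does not shrink vectors, the linearization error `c ‖x - y‖` is at most `c ‖A (x -
y)‖`. So `φ` and `A` distort distances by factors close to one relative to each other, and the image
under `A` has measure exactly `normDet` times volume. -/
theorem eventually_measure_image_bounds {φ : U → V} {A : U →L[ℝ] V} {x : U}
    (hφ : HasStrictFDerivAt φ A x) (hA : ∀ v, ‖v‖ ≤ ‖A v‖) {c : ℝ≥0} (hc : 0 < c) :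
    ∀ᶠ s in (𝓝 x).smallSets,
      μHE[finrank ℝ U] (φ '' s) ≤ ((1 + c : ℝ≥0) : ℝ≥0∞) ^ finrank ℝ U *
        (ENNReal.ofReal A.toLinearMap.normDet * volume s) ∧
      (ENNReal.ofReal A.toLinearMap.normDet * volume s) ≤
        ((1 + 2 * c : ℝ≥0) : ℝ≥0∞) ^ finrank ℝ U * μHE[finrank ℝ U] (φ '' s) := by
  -- The cap `1 / 2` gives `1 ≤ (1 + 2c)(1 - c')`, which is where the factor `1 + 2c` comes from.
  set c' : ℝ≥0 := min c (1 / 2) with hc'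
  have hc'0 : 0 < c' := lt_min hc (by norm_num)
  have hc1 : (c' : ℝ) ≤ c := by exact_mod_cast min_le_left _ _
  have hc2 : (c' : ℝ) ≤ 1 / 2 := by
    have : c' ≤ 1 / 2 := min_le_right _ _
    exact_mod_cast this
  obtain ⟨t, ht, happ⟩ := hφ.approximates_deriv_on_nhds (c := c') (Or.inr hc'0)
  filter_upwards [eventually_smallSets.2 ⟨t, ht, fun _ h => h⟩] with s hs
  have hb : ∀ x ∈ s, ∀ y ∈ s, ‖φ x - φ y - A (x - y)‖ ≤ c' * ‖x - y‖ :=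
    fun x hx y hy => happ x (hs hx) y (hs hy)
  have himg : ENNReal.ofReal A.toLinearMap.normDet * volume s =
      μHE[finrank ℝ U] ((A : U → V) '' s) :=
    (A.toLinearMap.euclideanHausdorffMeasure_image_eq_normDet_mul_volume s).symm
  rw [himg]
  constructor
  · apply euclideanHausdorffMeasure_image_le_of_dist_le
    intro x hx y hy
    have h1 := hb x hx y hy
    have h2 := hA (x - y)
    rw [dist_eq_norm, dist_eq_norm, ← map_sub]
    have h3 : ‖φ x - φ y‖ ≤ ‖φ x - φ y - A (x - y)‖ + ‖A (x - y)‖ := by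
      simpa using norm_add_le (φ x - φ y - A (x - y)) (A (x - y))
    push_cast
    nlinarith [norm_nonneg (x - y), c.coe_nonneg]
  · apply euclideanHausdorffMeasure_image_le_of_dist_le
    intro x hx y hy
    have h1 := hb x hx y hy
    have h2 := hA (x - y)
    rw [dist_eq_norm, dist_eq_norm, ← map_sub]
    have h3 : ‖A (x - y)‖ ≤ ‖φ x - φ y - A (x - y)‖ + ‖φ x - φ y‖ := by
      have := norm_sub_le (φ x - φ y) (φ x - φ y - A (x - y))
      rw [sub_sub_cancel] at this
      linarith
    push_cast
    have h4 : (1 - c') * ‖A (x - y)‖ ≤ ‖φ x - φ y‖ := by nlinarith [norm_nonneg (x - y)]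
    have h5 : (1 : ℝ) ≤ (1 + 2 * c) * (1 - c') := by nlinarith [c.coe_nonneg, c'.coe_nonneg]
    calc ‖A (x - y)‖ ≤ ((1 + 2 * c) * (1 - c')) * ‖A (x - y)‖ := by
          nlinarith [norm_nonneg (A (x - y))]
      _ = (1 + 2 * c) * ((1 - c') * ‖A (x - y)‖) := by ring
      _ ≤ _ := by gcongr

/-- The area formula for an expanding Lipschitz immersion. -/
theorem comap_euclideanHausdorffMeasure_eq_withDensity {φ : U → V} {K : ℝ≥0}
    (hφ : ContDiff ℝ 1 φ) (hexp : AntilipschitzWith 1 φ) (hlip : LipschitzWith K φ)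
    (hme : MeasurableEmbedding φ) :
    (μHE[finrank ℝ U] : Measure V).comap φ =
      volume.withDensity fun x => ENNReal.ofReal (fderiv ℝ φ x).toLinearMap.normDet := by
  set ν := (μHE[finrank ℝ U] : Measure V).comap φ with hν
  have hνs : ∀ s, ν s = μHE[finrank ℝ U] (φ '' s) := fun s => hme.comap_apply _ s
  have hle : ∀ s, ν s ≤ (K : ℝ≥0∞) ^ finrank ℝ U * volume s := by
    intro s
    rw [hνs, ← InnerProductSpace.euclideanHausdorffMeasure_eq_volume]
    simpa using euclideanHausdorffMeasure_image_le_of_dist_le (f := φ) (g := id) (s := s)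
      (finrank ℝ U) (fun x _ y _ => hlip.dist_le_mul x y)
  -- Local finiteness and absolute continuity both follow from the Lipschitz bound `hle`. The
  -- density of `ν` can then be computed almost everywhere as a limit of ratios over shrinking
  -- balls.
  have : IsLocallyFiniteMeasure ν := by
    refine ⟨fun x => ⟨Metric.closedBall x 1, Metric.closedBall_mem_nhds x one_pos, ?_⟩⟩
    refine (hle _).trans_lt (ENNReal.mul_lt_top ?_ ?_)
    · exact ENNReal.pow_lt_top ENNReal.coe_lt_top
    · exact (isCompact_closedBall x 1).measure_lt_top
  have hac : ν ≪ volume := by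
    intro s hs
    refine le_antisymm ((hle s).trans ?_) bot_le
    rw [hs, mul_zero]
  rw [← Measure.withDensity_rnDeriv_eq ν volume hac]
  refine withDensity_congr_ae ?_
  filter_upwards [Besicovitch.ae_tendsto_rnDeriv ν volume] with x hx
  set A := fderiv ℝ φ x with hAdef
  have hstrict : HasStrictFDerivAt φ A x := hφ.contDiffAt.hasStrictFDerivAt (by simp)
  have hA : ∀ v, ‖v‖ ≤ ‖A v‖ := by
    intro v
    have := hstrict.hasFDerivAt.hasLineDerivAt v
    have ht : Tendsto (fun t : ℝ => ‖t⁻¹ • (φ (x + t • v) - φ x)‖) (𝓝[≠] 0) (𝓝 ‖A v‖) :=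
      this.tendsto_slope_zero.norm
    refine ge_of_tendsto ht ?_
    filter_upwards [self_mem_nhdsWithin] with t ht0
    have h1 := hexp.le_mul_dist (x + t • v) x
    rw [dist_eq_norm, dist_eq_norm, add_sub_cancel_left, norm_smul, NNReal.coe_one, one_mul] at h1
    rw [norm_smul, norm_inv]
    have ht0' : 0 < ‖t‖ := norm_pos_iff.2 ht0
    rw [inv_mul_eq_div, le_div_iff₀ ht0', mul_comm]
    exact h1
  set J := ENNReal.ofReal A.toLinearMap.normDet with hJ
  set L := ν.rnDeriv volume x with hL
  have hsmall : Tendsto (fun r => Metric.closedBall x r) (𝓝[>] (0 : ℝ)) (𝓝 x).smallSets := by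
    rw [tendsto_smallSets_iff]
    intro t ht
    obtain ⟨ε, hε, hεt⟩ := Metric.nhds_basis_closedBall.mem_iff.1 ht
    filter_upwards [Ioo_mem_nhdsGT hε] with r hr
    exact (Metric.closedBall_subset_closedBall hr.2.le).trans hεt
  have key : ∀ c : ℝ≥0, 0 < c → L ≤ ((1 + c : ℝ≥0) : ℝ≥0∞) ^ finrank ℝ U * J ∧
      J ≤ ((1 + 2 * c : ℝ≥0) : ℝ≥0∞) ^ finrank ℝ U * L := by
    intro c hc
    have hev := hsmall.eventually (eventually_measure_image_bounds hstrict hA hc)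
    have hvol : ∀ᶠ r in 𝓝[>] (0 : ℝ), volume (Metric.closedBall x r) ≠ 0 ∧
        volume (Metric.closedBall x r) ≠ ⊤ := by
      filter_upwards [self_mem_nhdsWithin] with r hr
      exact ⟨(Metric.measure_closedBall_pos _ _ hr).ne',
        (isCompact_closedBall x r).measure_lt_top.ne⟩
    constructor
    · refine le_of_tendsto hx ?_
      filter_upwards [hev, hvol] with r hr hv
      rw [hνs]
      refine ENNReal.div_le_of_le_mul ?_
      rw [mul_assoc]
      exact hr.1
    · have hx' := ENNReal.Tendsto.const_mul (a := ((1 + 2 * c : ℝ≥0) : ℝ≥0∞) ^ finrank ℝ U) hx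
        (Or.inr (by finiteness))
      refine ge_of_tendsto hx' ?_
      filter_upwards [hev, hvol] with r hr hv
      rw [hνs, ← mul_div_assoc, ENNReal.le_div_iff_mul_le (Or.inl hv.1) (Or.inl hv.2)]
      exact hr.2
  -- Letting `c → 0` in `key` leaves `L ≤ J` and `J ≤ L`.
  have hlim : ∀ (a : ℝ≥0) (b : ℝ≥0∞), b ≠ ⊤ →
      Tendsto (fun c : ℝ≥0 => ((1 + a * c : ℝ≥0) : ℝ≥0∞) ^ finrank ℝ U * b) (𝓝[>] 0) (𝓝 b) := by
    intro a b hb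
    have h1 : Tendsto (fun c : ℝ≥0 => (1 + a * c) ^ finrank ℝ U * b.toNNReal) (𝓝 0)
        (𝓝 ((1 + a * 0) ^ finrank ℝ U * b.toNNReal)) :=
      Continuous.tendsto (by fun_prop) 0
    have h2 := (ENNReal.tendsto_coe.2 h1).mono_left (nhdsWithin_le_nhds (s := Ioi 0))
    rw [show ((fun c : ℝ≥0 => ((1 + a * c : ℝ≥0) : ℝ≥0∞) ^ finrank ℝ U * b)) =
      fun c : ℝ≥0 => (((1 + a * c) ^ finrank ℝ U * b.toNNReal : ℝ≥0) : ℝ≥0∞) by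
        ext c; push_cast; rw [ENNReal.coe_toNNReal hb]]
    simpa [ENNReal.coe_toNNReal hb] using h2
  have hJtop : J ≠ ⊤ := ENNReal.ofReal_ne_top
  have hLtop : L ≠ ⊤ := by
    have := (key 1 one_pos).1
    refine ne_top_of_le_ne_top ?_ this
    finiteness
  refine le_antisymm ?_ ?_
  · refine ge_of_tendsto (hlim 1 J hJtop) ?_
    filter_upwards [self_mem_nhdsWithin] with c hc
    simpa using (key c hc).1
  · refine ge_of_tendsto (hlim 2 L hLtop) ?_
    filter_upwards [self_mem_nhdsWithin] with c hc
    exact (key c hc).2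

end AreaFormula

/-! ### Graphs over a plane and their surface measure. -/

section Graph

/-- The Euclidean plane. -/
abbrev E2 : Type := EuclideanSpace ℝ (Fin 2)

/-- A Euclidean coordinate system of space, split into a plane and its unit normal. -/
structure Frame where
  origin : E3
  plane : E2 →ₗᵢ[ℝ] E3
  normal : E3
  norm_normal : ‖normal‖ = 1
  inner_plane_normal : ∀ v, inner ℝ (plane v) normal = 0

/-- The parametrization of the graph of `h` over the plane of the frame. -/
noncomputable def Frame.graph (Φ : Frame) (h : E2 → ℝ) (u : E2) : E3 := Φ.origin + Φ.plane u + h u • Φ.normal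

/-- The area element of the graph of `h`. -/
noncomputable def areaElement (h : E2 → ℝ) (u : E2) : ℝ := √(1 + ‖∇ h u‖ ^ 2)

theorem areaElement_sq (h : E2 → ℝ) (u : E2) : areaElement h u ^ 2 = 1 + ‖∇ h u‖ ^ 2 :=
  Real.sq_sqrt (by positivity)

theorem one_le_areaElement (h : E2 → ℝ) (u : E2) : 1 ≤ areaElement h u := by
  rw [areaElement, Real.one_le_sqrt]
  linarith [sq_nonneg ‖∇ h u‖]

theorem areaElement_pos (h : E2 → ℝ) (u : E2) : 0 < areaElement h u :=
  one_pos.trans_le (one_le_areaElement h u)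

variable (Φ : Frame) {h : E2 → ℝ}

theorem Frame.inner_normal_self : inner ℝ Φ.normal Φ.normal = (1 : ℝ) := by
  rw [real_inner_self_eq_norm_sq, Φ.norm_normal, one_pow]

theorem Frame.inner_normal_plane (v : E2) : inner ℝ Φ.normal (Φ.plane v) = (0 : ℝ) := by
  rw [real_inner_comm]; exact Φ.inner_plane_normal v

theorem Frame.inner_add_smul (v w : E2) (a b : ℝ) :
    inner ℝ (Φ.plane v + a • Φ.normal) (Φ.plane w + b • Φ.normal) = inner ℝ v w + a * b := by
  rw [inner_add_left, inner_add_right, inner_add_right, real_inner_smul_left, real_inner_smul_right,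
    real_inner_smul_left, real_inner_smul_right, Φ.inner_normal_self, Φ.inner_plane_normal,
    Φ.inner_normal_plane, LinearIsometry.inner_map_map]
  ring

theorem Frame.graph_sub (h : E2 → ℝ) (u v : E2) :
    Φ.graph h u - Φ.graph h v = Φ.plane (u - v) + (h u - h v) • Φ.normal := by
  simp only [Frame.graph, map_sub, sub_smul]
  abel

theorem Frame.norm_add_smul_sq (v : E2) (a : ℝ) :
    ‖Φ.plane v + a • Φ.normal‖ ^ 2 = ‖v‖ ^ 2 + a ^ 2 := by
  rw [← real_inner_self_eq_norm_sq, Φ.inner_add_smul, real_inner_self_eq_norm_sq]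
  ring

theorem Frame.norm_graph_sub_sq (h : E2 → ℝ) (u v : E2) :
    ‖Φ.graph h u - Φ.graph h v‖ ^ 2 = ‖u - v‖ ^ 2 + (h u - h v) ^ 2 := by
  rw [Φ.graph_sub, Φ.norm_add_smul_sq]

theorem Frame.norm_sub_le_norm_graph_sub (h : E2 → ℝ) (u v : E2) :
    ‖u - v‖ ≤ ‖Φ.graph h u - Φ.graph h v‖ := by
  refine le_of_sq_le_sq ?_ (norm_nonneg _)
  rw [Φ.norm_graph_sub_sq]
  linarith [sq_nonneg (h u - h v)]

theorem Frame.norm_graph_sub_le {K : ℝ≥0} (hK : LipschitzWith K h) (u v : E2) :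
    ‖Φ.graph h u - Φ.graph h v‖ ≤ (1 + K) * ‖u - v‖ := by
  rw [Φ.graph_sub]
  refine (norm_add_le _ _).trans ?_
  rw [norm_smul, Φ.norm_normal, mul_one, LinearIsometry.norm_map]
  have := hK.norm_sub_le u v
  linarith

theorem Frame.contDiff_graph {n : ℕ∞ω} (hh : ContDiff ℝ n h) : ContDiff ℝ n (Φ.graph h) := by
  unfold Frame.graph
  exact (contDiff_const.add Φ.plane.toContinuousLinearMap.contDiff).add (hh.smul contDiff_const)

theorem Frame.hasFDerivAt_graph {u : E2} (hh : DifferentiableAt ℝ h u) :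
    HasFDerivAt (Φ.graph h)
      (Φ.plane.toContinuousLinearMap + (fderiv ℝ h u).smulRight Φ.normal) u := by
  unfold Frame.graph
  exact (Φ.plane.toContinuousLinearMap.hasFDerivAt.const_add Φ.origin).add
    (hh.hasFDerivAt.smul_const Φ.normal)

theorem fderiv_eq_inner_gradient (h : E2 → ℝ) (u v : E2) : fderiv ℝ h u v = inner ℝ (∇ h u) v := by
  simp [gradient]

/-- In an orthonormal basis the Gram matrix of the derivative is `I + ∇h ∇hᵀ`, whose determinant is
`1 + ‖∇h‖²`. -/
theorem Frame.normDet_fderiv_graph {u : E2} (hh : DifferentiableAt ℝ h u) :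
    (fderiv ℝ (Φ.graph h) u).toLinearMap.normDet = areaElement h u := by
  rw [(Φ.hasFDerivAt_graph hh).fderiv]
  refine (sq_eq_sq₀ (LinearMap.normDet_nonneg _) (areaElement_pos h u).le).1 ?_
  have := LinearMap.normDet_sq_eq_det_gram
    (Φ.plane.toContinuousLinearMap + (fderiv ℝ h u).smulRight Φ.normal).toLinearMap
    (EuclideanSpace.basisFun (Fin 2) ℝ)
  simp only [RCLike.ofReal_real_eq_id, id] at this
  rw [this, areaElement_sq, Matrix.det_fin_two, EuclideanSpace.norm_sq_eq, Fin.sum_univ_two]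
  have key : ∀ i j : Fin 2, inner ℝ
      ((Φ.plane.toContinuousLinearMap + (fderiv ℝ h u).smulRight Φ.normal).toLinearMap
        (EuclideanSpace.basisFun (Fin 2) ℝ i))
      ((Φ.plane.toContinuousLinearMap + (fderiv ℝ h u).smulRight Φ.normal).toLinearMap
        (EuclideanSpace.basisFun (Fin 2) ℝ j)) =
      (if i = j then 1 else 0) + (∇ h u) i * (∇ h u) j := by
    intro i j
    have hl : ∀ i, (Φ.plane.toContinuousLinearMap + (fderiv ℝ h u).smulRight Φ.normal).toLinearMap
        (EuclideanSpace.basisFun (Fin 2) ℝ i) =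
        Φ.plane (EuclideanSpace.basisFun (Fin 2) ℝ i) + (∇ h u) i • Φ.normal := by
      intro i
      have hi : (∇ h u) i = fderiv ℝ h u (EuclideanSpace.basisFun (Fin 2) ℝ i) := by
        rw [fderiv_eq_inner_gradient, EuclideanSpace.basisFun_apply,
          EuclideanSpace.inner_single_right]
        simp
      rw [hi]
      simp [-inner_gradient_left]
    rw [hl, hl, Φ.inner_add_smul, orthonormal_iff_ite.1 (EuclideanSpace.basisFun (Fin 2) ℝ).orthonormal]
  simp only [Matrix.gram, Matrix.of_apply, key, Real.norm_eq_abs, sq_abs]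
  simp
  ring

theorem Frame.antilipschitzWith_graph (h : E2 → ℝ) : AntilipschitzWith 1 (Φ.graph h) :=
  AntilipschitzWith.of_le_mul_dist fun u v => by
    simpa [dist_eq_norm] using Φ.norm_sub_le_norm_graph_sub h u v

theorem Frame.measurableEmbedding_graph (hh : Continuous h) : MeasurableEmbedding (Φ.graph h) := by
  refine Continuous.measurableEmbedding ?_ (Φ.antilipschitzWith_graph h).injective
  unfold Frame.graph
  fun_prop

theorem Frame.comap_graph {K : ℝ≥0} (hh : ContDiff ℝ 1 h) (hK : LipschitzWith K h) :
    (μHE[2] : Measure E3).comap (Φ.graph h) =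
      volume.withDensity fun u => ENNReal.ofReal (areaElement h u) := by
  have hl : LipschitzWith (1 + K) (Φ.graph h) := LipschitzWith.of_dist_le_mul fun u v => by
    simpa [dist_eq_norm] using Φ.norm_graph_sub_le hK u v
  have := comap_euclideanHausdorffMeasure_eq_withDensity (Φ.contDiff_graph hh)
    (Φ.antilipschitzWith_graph h) hl (Φ.measurableEmbedding_graph hh.continuous)
  rw [finrank_euclideanSpace_fin] at this
  rw [this]
  congr with u
  rw [Φ.normDet_fderiv_graph (hh.differentiable (by simp) u)]

theorem continuous_areaElement (hh : ContDiff ℝ 1 h) : Continuous (areaElement h) := by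
  unfold areaElement gradient
  have := hh.continuous_fderiv (by simp)
  fun_prop

theorem Frame.restrict_graph_image {K : ℝ≥0} (hh : ContDiff ℝ 1 h) (hK : LipschitzWith K h)
    (t : Set E2) :
    (μHE[2] : Measure E3).restrict (Φ.graph h '' t) =
      ((volume.restrict t).withDensity fun u => ENNReal.ofReal (areaElement h u)).map
        (Φ.graph h) := by
  have hm := Φ.measurableEmbedding_graph hh.continuous
  have h1 := hm.map_comap (μHE[2] : Measure E3)
  rw [Φ.comap_graph hh hK] at h1
  have h2 : Φ.graph h ⁻¹' (Φ.graph h '' t) = t := preimage_image_eq _ hm.injective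
  have h3 : (μHE[2] : Measure E3).restrict (Φ.graph h '' t) =
      ((μHE[2] : Measure E3).restrict (range (Φ.graph h))).restrict (Φ.graph h '' t) := by
    rw [Measure.restrict_restrict_of_subset (image_subset_range _ _)]
  rw [h3, ← h1, hm.restrict_map, h2, restrict_withDensity' t]

theorem Frame.integrableOn_graph_image_iff {K : ℝ≥0} (hh : ContDiff ℝ 1 h) (hK : LipschitzWith K h)
    (t : Set E2) (F : E3 → ℝ) :
    IntegrableOn F (Φ.graph h '' t) μHE[2] ↔
      IntegrableOn (fun u => areaElement h u * F (Φ.graph h u)) t := by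
  rw [IntegrableOn, Φ.restrict_graph_image hh hK,
    (Φ.measurableEmbedding_graph hh.continuous).integrable_map_iff,
    integrable_withDensity_iff_integrable_smul' (by
      have := (continuous_areaElement hh).measurable
      fun_prop) (ae_of_all _ fun u => ENNReal.ofReal_lt_top), IntegrableOn]
  refine integrable_congr (ae_of_all _ fun u => ?_)
  simp [ENNReal.toReal_ofReal (areaElement_pos h u).le]

theorem Frame.setIntegral_graph_image {K : ℝ≥0} (hh : ContDiff ℝ 1 h) (hK : LipschitzWith K h)
    (t : Set E2) (F : E3 → ℝ) :
    ∫ x in Φ.graph h '' t, F x ∂μHE[2] = ∫ u in t, areaElement h u * F (Φ.graph h u) := by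
  rw [Φ.restrict_graph_image hh hK,
    (Φ.measurableEmbedding_graph hh.continuous).integral_map,
    integral_withDensity_eq_integral_toReal_smul (by
      have := (continuous_areaElement hh).measurable
      fun_prop) (ae_of_all _ fun u => ENNReal.ofReal_lt_top)]
  refine integral_congr_ae (ae_of_all _ fun u => ?_)
  simp [ENNReal.toReal_ofReal (areaElement_pos h u).le]

end Graph

/-! ### The shape factor, its decay, and the radial error kernel. -/

section Kernel

theorem hasDerivAt_erf (t : ℝ) : HasDerivAt erf (2 / √Real.pi * Real.exp (-t ^ 2)) t := by
  unfold erf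
  have hc : Continuous fun u : ℝ => Real.exp (-u ^ 2) := by fun_prop
  exact (intervalIntegral.integral_hasDerivAt_right (hc.intervalIntegrable _ _)
    (hc.stronglyMeasurableAtFilter _ _) hc.continuousAt).const_mul _

/-- The two plain Gaussian terms cancel. What is left is nonnegative, so `s` increases to its limit
`1`. -/
theorem hasDerivAt_shapeFactor (t : ℝ) :
    HasDerivAt shapeFactor (4 / √Real.pi * t ^ 2 * Real.exp (-t ^ 2)) t := by
  unfold shapeFactor
  have h1 : HasDerivAt (fun t : ℝ => Real.exp (-t ^ 2)) (Real.exp (-t ^ 2) * (-(2 * t))) t := by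
    have : HasDerivAt (fun t : ℝ => -t ^ 2) (-(2 * t)) t := by
      simpa using (hasDerivAt_pow 2 t).fun_neg
    exact this.exp
  have h2 : HasDerivAt (fun t : ℝ => 2 / √Real.pi * t) (2 / √Real.pi) t := by
    simpa using (hasDerivAt_id t).const_mul (2 / √Real.pi)
  refine ((hasDerivAt_erf t).sub (h2.mul h1)).congr_deriv ?_
  ring

theorem continuous_shapeFactor : Continuous shapeFactor :=
  continuous_iff_continuousAt.2 fun t => (hasDerivAt_shapeFactor t).continuousAt

/-- Polynomial decay is all that is used later; the exponent 9 leaves room to spare. -/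
theorem exp_neg_sq_le {t : ℝ} (ht : 0 ≤ t) :
    Real.exp (-t ^ 2) ≤ Nat.factorial 9 * Real.exp 2 / (1 + t) ^ 9 := by
  rw [le_div_iff₀ (by positivity)]
  have h1 := Real.pow_div_factorial_le_exp (x := 1 + t) (by linarith) 9
  rw [div_le_iff₀ (by positivity)] at h1
  calc Real.exp (-t ^ 2) * (1 + t) ^ 9
      ≤ Real.exp (-t ^ 2) * (Real.exp (1 + t) * Nat.factorial 9) := by gcongr
    _ = Nat.factorial 9 * Real.exp (-t ^ 2 + (1 + t)) := by
      rw [Real.exp_add (-t ^ 2)]; ring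
    _ ≤ Nat.factorial 9 * Real.exp 2 := by
      gcongr
      nlinarith [sq_nonneg (t - 1 / 2)]

theorem tendsto_erf : Tendsto erf atTop (𝓝 1) := by
  have h1 : IntegrableOn (fun u : ℝ => Real.exp (-u ^ 2)) (Ioi 0) := by
    simpa using (integrable_exp_neg_mul_sq one_pos).integrableOn (s := Ioi (0 : ℝ))
  have h2 := intervalIntegral_tendsto_integral_Ioi 0 h1 tendsto_id
  have h3 : ∫ u in Ioi (0 : ℝ), Real.exp (-u ^ 2) = √Real.pi / 2 := by
    simpa using integral_gaussian_Ioi 1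
  rw [h3] at h2
  have h4 := h2.const_mul (2 / √Real.pi)
  have h5 : 2 / √Real.pi * (√Real.pi / 2) = 1 := by
    have := Real.sqrt_pos.2 Real.pi_pos
    field_simp
  rw [h5] at h4
  exact h4

theorem tendsto_shapeFactor : Tendsto shapeFactor atTop (𝓝 1) := by
  unfold shapeFactor
  have h : Tendsto (fun t : ℝ => 2 / √Real.pi * t * Real.exp (-t ^ 2)) atTop (𝓝 0) := by
    have h0 : Tendsto (fun t : ℝ => 2 / √Real.pi * (Nat.factorial 9 * Real.exp 2) * t⁻¹) atTop
        (𝓝 0) := by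
      simpa using tendsto_inv_atTop_zero.const_mul (2 / √Real.pi * (Nat.factorial 9 * Real.exp 2))
    refine squeeze_zero' ?_ ?_ h0
    · filter_upwards [eventually_ge_atTop 0] with t ht
      positivity
    · filter_upwards [eventually_ge_atTop 1] with t ht
      have h1 := exp_neg_sq_le (t := t) (by linarith)
      have h2 : t * t ≤ (1 + t) ^ 9 := by
        calc t * t ≤ (1 + t) ^ 2 := by nlinarith
          _ ≤ (1 + t) ^ 9 := pow_le_pow_right₀ (by linarith) (by norm_num)
      rw [mul_assoc, mul_assoc]
      refine mul_le_mul_of_nonneg_left ?_ (by positivity)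
      calc t * Real.exp (-t ^ 2) ≤ t * (Nat.factorial 9 * Real.exp 2 / (t * t)) := by
            gcongr
            refine h1.trans ?_
            gcongr
        _ = _ := by field_simp
  simpa using tendsto_erf.sub h

theorem monotone_shapeFactor : Monotone shapeFactor :=
  monotone_of_hasDerivAt_nonneg (fun t => hasDerivAt_shapeFactor t) fun t => by
    simp only [Pi.zero_apply]; positivity

theorem shapeFactor_le_one (t : ℝ) : shapeFactor t ≤ 1 :=
  monotone_shapeFactor.ge_of_tendsto tendsto_shapeFactor t

theorem exists_deriv_shapeFactor_bound : ∃ C : ℝ, 0 < C ∧ ∀ t : ℝ, 0 ≤ t →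
    4 / √Real.pi * t ^ 2 * Real.exp (-t ^ 2) ≤ C / (1 + t) ^ 5 := by
  refine ⟨4 / √Real.pi * (Nat.factorial 9 * Real.exp 2), by positivity, fun t ht => ?_⟩
  rw [le_div_iff₀ (by positivity), mul_assoc, mul_assoc]
  refine mul_le_mul_of_nonneg_left ?_ (by positivity)
  have h1 := exp_neg_sq_le ht
  rw [le_div_iff₀ (by positivity)] at h1
  refine le_trans ?_ h1
  have h2 : t ^ 2 * (1 + t) ^ 5 ≤ (1 + t) ^ 9 := by
    calc t ^ 2 * (1 + t) ^ 5 ≤ (1 + t) ^ 2 * (1 + t) ^ 5 := by gcongr; linarith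
      _ = (1 + t) ^ 7 := by ring
      _ ≤ (1 + t) ^ 9 := pow_le_pow_right₀ (by linarith) (by norm_num)
  have := Real.exp_pos (-t ^ 2)
  nlinarith

/-- Rapid decay of the shape factor towards one, together with its derivative. -/
theorem exists_shapeFactor_decay : ∃ C : ℝ, 0 < C ∧ ∀ t : ℝ, 0 ≤ t →
    1 - shapeFactor t ≤ C / (1 + t) ^ 4 ∧
    t * (4 / √Real.pi * t ^ 2 * Real.exp (-t ^ 2)) ≤ C / (1 + t) ^ 4 := by
  obtain ⟨C, hC, hb⟩ := exists_deriv_shapeFactor_bound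
  refine ⟨C, hC, fun t ht => ⟨?_, ?_⟩⟩
  · have hd : ∀ x ∈ Ici (0 : ℝ), HasDerivAt (fun x => C * ((1 + x) ^ 4)⁻¹ - (1 - shapeFactor x))
        (C * (-(4 * (1 + x) ^ 3) / ((1 + x) ^ 4) ^ 2) -
          (-(4 / √Real.pi * x ^ 2 * Real.exp (-x ^ 2)))) x := by
      intro x hx
      have hx0 : (1 + x) ^ 4 ≠ 0 := by
        have : (0 : ℝ) ≤ x := hx
        positivity
      have h1 : HasDerivAt (fun x : ℝ => (1 + x) ^ 4) (4 * (1 + x) ^ 3) x := by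
        simpa using ((hasDerivAt_id x).const_add 1).fun_pow 4
      exact ((h1.inv hx0).const_mul C).sub ((hasDerivAt_shapeFactor x).const_sub 1)
    -- The derivative of `C (1 + x)⁻⁴` is `-4 C / (1 + x)⁵`, which outweighs `s' ≤ C / (1 + x)⁵`. A
    -- decreasing function with limit zero is nonnegative.
    have hanti : AntitoneOn (fun x => C * ((1 + x) ^ 4)⁻¹ - (1 - shapeFactor x)) (Ici 0) := by
      refine antitoneOn_of_hasDerivWithinAt_nonpos (convex_Ici 0)
        (fun x hx => (hd x hx).continuousAt.continuousWithinAt)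
        (fun x hx => (hd x (interior_subset hx)).hasDerivWithinAt) fun x hx => ?_
      have hx0 : (0 : ℝ) ≤ x := interior_subset hx
      have h1 := hb x hx0
      have h2 : C * (-(4 * (1 + x) ^ 3) / ((1 + x) ^ 4) ^ 2) = -(4 * (C / (1 + x) ^ 5)) := by
        field_simp
      rw [h2]
      have : 0 ≤ C / (1 + x) ^ 5 := by positivity
      linarith
    have hlim : Tendsto (fun x => C * ((1 + x) ^ 4)⁻¹ - (1 - shapeFactor x)) atTop (𝓝 0) := by
      have h1 : Tendsto (fun x : ℝ => (1 + x) ^ 4) atTop atTop :=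
        (tendsto_pow_atTop (by norm_num)).comp (tendsto_atTop_add_const_left _ _ tendsto_id)
      simpa using (h1.inv_tendsto_atTop.const_mul C).sub (tendsto_shapeFactor.const_sub 1)
    have := le_of_tendsto (b := C * ((1 + t) ^ 4)⁻¹ - (1 - shapeFactor t)) hlim
      (by
        filter_upwards [eventually_ge_atTop t] with x hx
        exact hanti ht (ht.trans hx) hx)
    rw [div_eq_mul_inv]
    linarith
  · have h1 := hb t ht
    calc t * (4 / √Real.pi * t ^ 2 * Real.exp (-t ^ 2)) ≤ (1 + t) * (C / (1 + t) ^ 5) := by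
          gcongr
          linarith
      _ = C / (1 + t) ^ 4 := by field_simp

/-- The radial factor of the difference of the regularized and the exact gradient. -/
noncomputable def errorKernel (δ r : ℝ) : ℝ := (shapeFactor (r / δ) - 1) / (4 * Real.pi * r ^ 3)

theorem hasDerivAt_errorKernel {δ r : ℝ} (hδ : 0 < δ) (hr : 0 < r) :
    HasDerivAt (errorKernel δ)
      ((r / δ * (4 / √Real.pi * (r / δ) ^ 2 * Real.exp (-(r / δ) ^ 2)) -
        3 * (shapeFactor (r / δ) - 1)) / (4 * Real.pi * r ^ 4)) r := by
  unfold errorKernel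
  have h1 : HasDerivAt (fun r => shapeFactor (r / δ) - 1)
      (4 / √Real.pi * (r / δ) ^ 2 * Real.exp (-(r / δ) ^ 2) * (1 / δ)) r :=
    (HasDerivAt.comp (h := fun r => r / δ) r (hasDerivAt_shapeFactor (r / δ))
      ((hasDerivAt_id r).div_const δ)).sub_const 1
  have h2 : HasDerivAt (fun r : ℝ => 4 * Real.pi * r ^ 3) (4 * Real.pi * (3 * r ^ 2)) r := by
    simpa using (hasDerivAt_pow 3 r).const_mul (4 * Real.pi)
  refine (h1.div h2 (by positivity)).congr_deriv ?_
  have := Real.pi_pos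
  have := Real.sqrt_pos.2 Real.pi_pos
  field_simp

/-- With `t = r/δ`, the derivative of the kernel is `(t s'(t) + 3 (1 - s(t))) / (4πr⁴)`. Both terms
decay like `(1 + t)⁻⁴`, and the mean value inequality on `[m, ∞)` gives the slope bound. Later `m =
‖w‖`, a common lower bound for the distances at `w` and `-w`. -/
theorem exists_errorKernel_bounds : ∃ C : ℝ, 0 < C ∧ ∀ δ m : ℝ, 0 < δ → 0 < m →
    (∀ r, m ≤ r → |errorKernel δ r| ≤ C / (m ^ 3 * (1 + m / δ) ^ 4)) ∧
    ∀ r, m ≤ r → ∀ r', m ≤ r' →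
      |errorKernel δ r - errorKernel δ r'| ≤ C / (m ^ 4 * (1 + m / δ) ^ 4) * |r - r'| := by
  obtain ⟨C, hC, hb⟩ := exists_shapeFactor_decay
  have hpi : (1 : ℝ) ≤ Real.pi := by linarith [Real.two_le_pi]
  refine ⟨C, hC, fun δ m hδ hm => ⟨fun r hr => ?_, ?_⟩⟩
  · have hr0 : 0 < r := hm.trans_le hr
    have h1 := (hb (r / δ) (by positivity)).1
    rw [errorKernel, abs_div, abs_of_nonpos (by linarith [shapeFactor_le_one (r / δ)]),
      abs_of_pos (by positivity), neg_sub]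
    calc (1 - shapeFactor (r / δ)) / (4 * Real.pi * r ^ 3)
        ≤ (C / (1 + r / δ) ^ 4) / (r ^ 3) := by
          gcongr
          nlinarith [pow_pos hr0 3]
      _ = C / (r ^ 3 * (1 + r / δ) ^ 4) := by field_simp
      _ ≤ C / (m ^ 3 * (1 + m / δ) ^ 4) := by gcongr
  · have key : ∀ x ∈ Ici m, ‖(x / δ * (4 / √Real.pi * (x / δ) ^ 2 * Real.exp (-(x / δ) ^ 2)) -
        3 * (shapeFactor (x / δ) - 1)) / (4 * Real.pi * x ^ 4)‖ ≤
          C / (m ^ 4 * (1 + m / δ) ^ 4) := by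
      intro x hx
      have hx' : m ≤ x := hx
      have hx0 : 0 < x := hm.trans_le hx'
      obtain ⟨h1, h2⟩ := hb (x / δ) (by positivity)
      have h3 : 0 ≤ x / δ * (4 / √Real.pi * (x / δ) ^ 2 * Real.exp (-(x / δ) ^ 2)) := by positivity
      have h4 := shapeFactor_le_one (x / δ)
      rw [Real.norm_eq_abs, abs_div, abs_of_nonneg (by linarith), abs_of_pos (by positivity)]
      calc _ ≤ (4 * (C / (1 + x / δ) ^ 4)) / (4 * x ^ 4) := by
            gcongr
            · linarith
            · nlinarith [pow_pos hx0 4]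
        _ = C / (x ^ 4 * (1 + x / δ) ^ 4) := by field_simp
        _ ≤ C / (m ^ 4 * (1 + m / δ) ^ 4) := by gcongr
    intro r hr r' hr'
    exact (convex_Ici m).norm_image_sub_le_of_norm_hasDerivWithin_le
      (fun x hx => (hasDerivAt_errorKernel hδ (hm.trans_le hx)).hasDerivWithinAt) key hr' hr

theorem hasGradientAt_radial {ψ : ℝ → ℝ} {ψ' : ℝ} {z : E3} (hz : z ≠ 0)
    (hψ : HasDerivAt ψ ψ' ‖z‖) : HasGradientAt (fun z : E3 => ψ ‖z‖) ((ψ' / ‖z‖) • z) z := by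
  have hz0 : 0 < ‖z‖ := norm_pos_iff.2 hz
  have h1 : HasFDerivAt (fun z : E3 => ‖z‖ ^ 2) (2 • innerSL ℝ z) z :=
    (hasStrictFDerivAt_norm_sq z).hasFDerivAt
  have h2 := h1.sqrt (by positivity)
  have h3 : (fun z : E3 => √(‖z‖ ^ 2)) = fun z => ‖z‖ := by
    ext z; exact Real.sqrt_sq (norm_nonneg z)
  rw [h3] at h2
  rw [hasGradientAt_iff_hasFDerivAt]
  refine (hψ.comp_hasFDerivAt z h2).congr_fderiv ?_
  ext v
  simp [Real.sqrt_sq hz0.le]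
  field_simp

theorem hasGradientAt_green {z : E3} (hz : z ≠ 0) :
    HasGradientAt green ((1 / (4 * Real.pi * ‖z‖ ^ 3)) • z) z := by
  have hz0 : 0 < ‖z‖ := norm_pos_iff.2 hz
  have h1 : HasDerivAt (fun r : ℝ => -1 / (4 * Real.pi * r)) (1 / (4 * Real.pi * ‖z‖ ^ 2)) ‖z‖ := by
    refine ((hasDerivAt_const ‖z‖ (-1 : ℝ)).div
      ((hasDerivAt_id ‖z‖).const_mul (4 * Real.pi)) (by simp; positivity)).congr_deriv ?_
    simp only [id]
    field_simp
    ring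
  have h2 := hasGradientAt_radial hz h1
  have h3 : 1 / (4 * Real.pi * ‖z‖ ^ 2) / ‖z‖ = 1 / (4 * Real.pi * ‖z‖ ^ 3) := by
    field_simp
  rw [h3] at h2
  exact h2

theorem hasGradientAt_greenReg {z : E3} (hz : z ≠ 0) {δ : ℝ} (hδ : 0 < δ) :
    HasGradientAt (greenReg δ) (shapeFactor (‖z‖ / δ) • ∇ green z) z := by
  have hz0 : 0 < ‖z‖ := norm_pos_iff.2 hz
  have h1 : HasDerivAt (fun r : ℝ => -1 / (4 * Real.pi * r) * erf (r / δ))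
      (shapeFactor (‖z‖ / δ) / (4 * Real.pi * ‖z‖ ^ 2)) ‖z‖ := by
    have ha := ((hasDerivAt_const ‖z‖ (-1 : ℝ)).fun_div
      ((hasDerivAt_id ‖z‖).const_mul (4 * Real.pi)) (by simp; positivity))
    have hb := (hasDerivAt_erf (‖z‖ / δ)).comp ‖z‖ ((hasDerivAt_id ‖z‖).div_const δ)
    refine (ha.fun_mul hb).congr_deriv ?_
    simp only [id, Function.comp, shapeFactor]
    have := Real.sqrt_pos.2 Real.pi_pos
    field_simp
    ring
  have h2 := hasGradientAt_radial hz h1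
  rw [(hasGradientAt_green hz).gradient, smul_smul]
  have h3 : shapeFactor (‖z‖ / δ) / (4 * Real.pi * ‖z‖ ^ 2) / ‖z‖ =
      shapeFactor (‖z‖ / δ) * (1 / (4 * Real.pi * ‖z‖ ^ 3)) := by
    field_simp
  rw [h3] at h2
  exact h2

theorem gradient_greenReg_sub_gradient_green {z : E3} (hz : z ≠ 0) {δ : ℝ} (hδ : 0 < δ) :
    ∇ (greenReg δ) z - ∇ green z = errorKernel δ ‖z‖ • z := by
  have hz0 : 0 < ‖z‖ := norm_pos_iff.2 hz
  rw [(hasGradientAt_greenReg hz hδ).gradient, (hasGradientAt_green hz).gradient, smul_smul,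
    ← sub_smul, errorKernel]
  congr 1
  field_simp

end Kernel

/-! ### Taylor expansion along lines, with uniform constants. -/

section Taylor

/-- On `[-1, 1]` integration from `0` does not enlarge the constant, so iterating this yields Taylor
remainders without factorials. Both ends are needed, since `t = 1` and `t = -1` give the
displacements `w` and `-w`. -/
theorem abs_le_of_hasDerivAt_of_abs_le {q q' : ℝ → ℝ} {K : ℝ} (h0 : q 0 = 0)
    (hd : ∀ t, HasDerivAt q (q' t) t) (hb : ∀ t ∈ Icc (-1 : ℝ) 1, |q' t| ≤ K) :
    ∀ t ∈ Icc (-1 : ℝ) 1, |q t| ≤ K := by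
  intro t ht
  have hK : 0 ≤ K := (abs_nonneg _).trans (hb 0 (by simp))
  have := (convex_Icc (-1 : ℝ) 1).norm_image_sub_le_of_norm_hasDerivWithin_le
    (fun x _ => (hd x).hasDerivWithinAt) hb (show (0 : ℝ) ∈ Icc (-1 : ℝ) 1 by simp) ht
  rw [h0, sub_zero, sub_zero, Real.norm_eq_abs, Real.norm_eq_abs] at this
  refine this.trans (mul_le_of_le_one_right hK (abs_le.2 ht))

theorem abs_sub_taylor_one_le {q₀ q₁ q₂ : ℝ → ℝ} {K : ℝ}
    (h₀ : ∀ t, HasDerivAt q₀ (q₁ t) t) (h₁ : ∀ t, HasDerivAt q₁ (q₂ t) t) (hK : ∀ t, |q₂ t| ≤ K)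
    {t : ℝ} (ht : t ∈ Icc (-1 : ℝ) 1) : |q₀ t - q₀ 0 - q₁ 0 * t| ≤ K := by
  have b₁ := abs_le_of_hasDerivAt_of_abs_le (q := fun t => q₁ t - q₁ 0) (by simp)
    (fun t => (h₁ t).sub_const _) (fun t _ => hK t)
  have hid := fun t : ℝ => hasDerivAt_id t
  exact abs_le_of_hasDerivAt_of_abs_le (q := fun t => q₀ t - q₀ 0 - q₁ 0 * t) (by simp)
    (fun t => (((h₀ t).sub_const _).sub ((hid t).const_mul (q₁ 0))).congr_deriv (by simp)) b₁ t ht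

theorem abs_sub_taylor_two_le {q₀ q₁ q₂ q₃ : ℝ → ℝ} {K : ℝ}
    (h₀ : ∀ t, HasDerivAt q₀ (q₁ t) t) (h₁ : ∀ t, HasDerivAt q₁ (q₂ t) t)
    (h₂ : ∀ t, HasDerivAt q₂ (q₃ t) t) (hK : ∀ t, |q₃ t| ≤ K)
    {t : ℝ} (ht : t ∈ Icc (-1 : ℝ) 1) : |q₀ t - q₀ 0 - q₁ 0 * t - q₂ 0 / 2 * t ^ 2| ≤ K := by
  have hid := fun t : ℝ => hasDerivAt_id t
  exact abs_le_of_hasDerivAt_of_abs_le (q := fun t => q₀ t - q₀ 0 - q₁ 0 * t - q₂ 0 / 2 * t ^ 2)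
    (by simp)
    (fun t => ((((h₀ t).sub_const _).sub ((hid t).const_mul (q₁ 0))).sub
      ((hasDerivAt_pow 2 t).const_mul (q₂ 0 / 2))).congr_deriv (by
        show _ = q₁ t - q₁ 0 - q₂ 0 * t
        simp; ring)) (fun t ht => abs_sub_taylor_one_le h₁ h₂ hK ht) t ht

theorem abs_sub_taylor_three_le {q₀ q₁ q₂ q₃ q₄ : ℝ → ℝ} {K : ℝ}
    (h₀ : ∀ t, HasDerivAt q₀ (q₁ t) t) (h₁ : ∀ t, HasDerivAt q₁ (q₂ t) t)
    (h₂ : ∀ t, HasDerivAt q₂ (q₃ t) t) (h₃ : ∀ t, HasDerivAt q₃ (q₄ t) t) (hK : ∀ t, |q₄ t| ≤ K)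
    {t : ℝ} (ht : t ∈ Icc (-1 : ℝ) 1) :
    |q₀ t - q₀ 0 - q₁ 0 * t - q₂ 0 / 2 * t ^ 2 - q₃ 0 / 6 * t ^ 3| ≤ K := by
  have hid := fun t : ℝ => hasDerivAt_id t
  exact abs_le_of_hasDerivAt_of_abs_le
    (q := fun t => q₀ t - q₀ 0 - q₁ 0 * t - q₂ 0 / 2 * t ^ 2 - q₃ 0 / 6 * t ^ 3) (by simp)
    (fun t => (((((h₀ t).sub_const _).sub ((hid t).const_mul (q₁ 0))).sub
      ((hasDerivAt_pow 2 t).const_mul (q₂ 0 / 2))).sub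
      ((hasDerivAt_pow 3 t).const_mul (q₃ 0 / 6))).congr_deriv (by
        show _ = q₁ t - q₁ 0 - q₂ 0 * t - q₃ 0 / 2 * t ^ 2
        simp; ring)) (fun t ht => abs_sub_taylor_two_le h₁ h₂ h₃ hK ht) t ht

variable {E : Type*} [NormedAddCommGroup E] [NormedSpace ℝ E]

theorem hasDerivAt_iteratedFDeriv_line {g : E → ℝ} {n : ℕ} (hg : ContDiff ℝ n g) {k : ℕ}
    (hk : k < n) (u w : E) (t : ℝ) :
    HasDerivAt (fun t : ℝ => iteratedFDeriv ℝ k g (u + t • w) fun _ => w)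
      (iteratedFDeriv ℝ (k + 1) g (u + t • w) fun _ => w) t := by
  have h1 := (hg.differentiable_iteratedFDeriv (m := k) (by exact_mod_cast hk)
    (u + t • w)).hasFDerivAt
  have h2 : HasDerivAt (fun t : ℝ => u + t • w) w t := by
    simpa using ((hasDerivAt_id t).smul_const w).const_add u
  have h3 := h1.comp_hasDerivAt t h2
  have h4 := (ContinuousMultilinearMap.apply ℝ (fun _ : Fin k => E) ℝ
    (fun _ => w)).hasFDerivAt.comp_hasDerivAt t h3
  rw [iteratedFDeriv_succ_apply_left]
  exact h4

/-- Compact support makes the constant independent of the base point `u`, hence of the pole of the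
kernel. -/
theorem exists_iteratedFDeriv_bound {g : E → ℝ} {n : ℕ} (hg : ContDiff ℝ n g)
    (hc : HasCompactSupport g) :
    ∃ C : ℝ, 0 < C ∧ ∀ k ≤ n, ∀ u w, |iteratedFDeriv ℝ k g u fun _ => w| ≤ C * ‖w‖ ^ k := by
  have h1 : ∀ k : ℕ, ∃ C : ℝ, k ≤ n → ∀ u, ‖iteratedFDeriv ℝ k g u‖ ≤ C := by
    intro k
    by_cases hk : k ≤ n
    · obtain ⟨C, hC⟩ := (hc.iteratedFDeriv (𝕜 := ℝ) k).exists_bound_of_continuous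
        (hg.continuous_iteratedFDeriv (m := k) (by exact_mod_cast hk))
      exact ⟨C, fun _ => hC⟩
    · exact ⟨0, fun h => absurd h hk⟩
  choose C hC using h1
  refine ⟨1 + ∑ k ∈ Finset.range (n + 1), |C k|, by positivity, fun k hk u w => ?_⟩
  have h2 := (iteratedFDeriv ℝ k g u).le_opNorm fun _ => w
  rw [Finset.prod_const, Finset.card_univ, Fintype.card_fin] at h2
  refine h2.trans ?_
  gcongr
  have h3 : |C k| ≤ ∑ k ∈ Finset.range (n + 1), |C k| :=
    Finset.single_le_sum (f := fun k => |C k|) (fun _ _ => abs_nonneg _)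
      (Finset.mem_range.2 (by omega))
  linarith [hC k hk u, le_abs_self (C k)]

theorem iteratedFDeriv_one_apply_const (g : E → ℝ) (u w : E) :
    (iteratedFDeriv ℝ 1 g u fun _ => w) = fderiv ℝ g u w := by
  rw [iteratedFDeriv_one_apply]

/-- First and second differences of a compactly supported function of class `C²`. -/
theorem exists_difference_bounds {g : E → ℝ} (hg : ContDiff ℝ 2 g) (hc : HasCompactSupport g) :
    ∃ C : ℝ, 0 < C ∧ ∀ u w, |g u| ≤ C ∧ |g (u + w) - g u| ≤ C * ‖w‖ ∧
      |g (u + w) + g (u - w) - 2 * g u| ≤ C * ‖w‖ ^ 2 := by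
  obtain ⟨C, hC, hb⟩ := exists_iteratedFDeriv_bound (n := 2) hg hc
  refine ⟨2 * C, by positivity, fun u w => ⟨?_, ?_, ?_⟩⟩
  · have := hb 0 (by norm_num) u 0
    simp only [iteratedFDeriv_zero_apply, pow_zero, mul_one] at this
    linarith
  · have := abs_le_of_hasDerivAt_of_abs_le (K := C * ‖w‖)
      (q := fun t => (iteratedFDeriv ℝ 0 g (u + t • w) fun _ => w) -
        (iteratedFDeriv ℝ 0 g (u + (0 : ℝ) • w) fun _ => w)) (by simp)
      (fun t => (hasDerivAt_iteratedFDeriv_line (n := 2) hg (by norm_num) u w t).sub_const _)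
      (fun t _ => by simpa using hb 1 (by norm_num) (u + t • w) w) 1 (by simp)
    simp only [iteratedFDeriv_zero_apply, one_smul, zero_smul, add_zero] at this
    have h0 : 0 ≤ C * ‖w‖ := by positivity
    linarith
  · have h := fun {t : ℝ} (ht : t ∈ Icc (-1 : ℝ) 1) => abs_sub_taylor_one_le
      (hasDerivAt_iteratedFDeriv_line (n := 2) hg (k := 0) (by norm_num) u w)
      (hasDerivAt_iteratedFDeriv_line (n := 2) hg (k := 1) (by norm_num) u w)
      (fun t => hb 2 le_rfl (u + t • w) w) ht
    have hp := h (t := 1) (by simp)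
    have hm := h (t := -1) (by simp)
    simp only [iteratedFDeriv_zero_apply, one_smul, zero_smul, add_zero, neg_smul,
      ← sub_eq_add_neg] at hp hm
    rw [abs_le] at hp hm ⊢
    constructor <;> linarith [hp.1, hp.2, hm.1, hm.2]

/-- The numerator of the double layer kernel in graph coordinates. -/
noncomputable def sourceDefect (h : E → ℝ) (u w : E) : ℝ := h (u + w) - h u - fderiv ℝ h (u + w) w

/-- The numerator of the adjoint double layer kernel in graph coordinates. -/
noncomputable def targetDefect (h : E → ℝ) (u w : E) : ℝ := h (u + w) - h u - fderiv ℝ h u w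

/-- With `A2` and `A3` the second and third derivatives at `u` along `w`, the source defect is
`-A2/2 - A3/3` and the target defect `A2/2 + A3/6`, up to fourth order. In the sum `A2` cancels and
the odd term `-A3/6` remains. -/
theorem exists_defect_bounds {h : E → ℝ} (hh : ContDiff ℝ 4 h) (hc : HasCompactSupport h) :
    ∃ C : ℝ, 0 < C ∧ ∀ u w, ‖w‖ ≤ 1 →
      |sourceDefect h u w| ≤ C * ‖w‖ ^ 2 ∧ |targetDefect h u w| ≤ C * ‖w‖ ^ 2 ∧
      |sourceDefect h u w - sourceDefect h u (-w)| ≤ C * ‖w‖ ^ 3 ∧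
      |targetDefect h u w - targetDefect h u (-w)| ≤ C * ‖w‖ ^ 3 ∧
      |sourceDefect h u w + targetDefect h u w| ≤ C * ‖w‖ ^ 3 ∧
      |sourceDefect h u w + targetDefect h u w +
        (sourceDefect h u (-w) + targetDefect h u (-w))| ≤ C * ‖w‖ ^ 4 := by
  obtain ⟨C, hC, hb⟩ := exists_iteratedFDeriv_bound (n := 4) hh hc
  refine ⟨8 * C, by positivity, fun u w hw => ?_⟩
  have hd := fun {k : ℕ} (hk : k < 4) => hasDerivAt_iteratedFDeriv_line (n := 4) hh hk u w
  have hK : ∀ t : ℝ, |iteratedFDeriv ℝ 4 h (u + t • w) fun _ => w| ≤ C * ‖w‖ ^ 4 :=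
    fun t => hb 4 le_rfl (u + t • w) w
  have h0 := fun {t : ℝ} (ht : t ∈ Icc (-1 : ℝ) 1) => abs_sub_taylor_three_le
    (hd (k := 0) (by norm_num)) (hd (k := 1) (by norm_num)) (hd (k := 2) (by norm_num))
    (hd (k := 3) (by norm_num)) hK ht
  have h1 := fun {t : ℝ} (ht : t ∈ Icc (-1 : ℝ) 1) => abs_sub_taylor_two_le
    (hd (k := 1) (by norm_num)) (hd (k := 2) (by norm_num)) (hd (k := 3) (by norm_num)) hK ht
  have p0 := h0 (t := 1) (by simp)
  have m0 := h0 (t := -1) (by simp)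
  have p1 := h1 (t := 1) (by simp)
  have m1 := h1 (t := -1) (by simp)
  have a2 := hb 2 (by norm_num) u w
  have a3 := hb 3 (by norm_num) u w
  simp only [iteratedFDeriv_zero_apply, iteratedFDeriv_one_apply_const,
    one_smul, zero_smul, add_zero, neg_smul, ← sub_eq_add_neg, Nat.reduceAdd] at p0 m0 p1 m1
  simp only [sourceDefect, targetDefect, ← sub_eq_add_neg, map_neg]
  -- From here every claim is linear in `A2`, `A3`, the values of `h` and its first derivatives at
  -- `u`, `u + w`, `u - w`. The factor 8 covers the accumulated remainders.
  generalize (iteratedFDeriv ℝ 2 h u fun _ => w) = A2 at *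
  generalize (iteratedFDeriv ℝ 3 h u fun _ => w) = A3 at *
  have w0 := norm_nonneg w
  have w4 : C * ‖w‖ ^ 4 ≤ C * ‖w‖ ^ 3 := by
    gcongr C * ?_; exact pow_le_pow_of_le_one w0 hw (by norm_num)
  have w3 : C * ‖w‖ ^ 3 ≤ C * ‖w‖ ^ 2 := by
    gcongr C * ?_; exact pow_le_pow_of_le_one w0 hw (by norm_num)
  have w40 : 0 ≤ C * ‖w‖ ^ 4 := by positivity
  rw [abs_le] at p0 m0 p1 m1 a2 a3
  obtain ⟨p01, p02⟩ := p0
  obtain ⟨m01, m02⟩ := m0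
  obtain ⟨p11, p12⟩ := p1
  obtain ⟨m11, m12⟩ := m1
  obtain ⟨a21, a22⟩ := a2
  obtain ⟨a31, a32⟩ := a3
  simp only [abs_le]
  refine ⟨⟨?_, ?_⟩, ⟨?_, ?_⟩, ⟨?_, ?_⟩, ⟨?_, ?_⟩, ⟨?_, ?_⟩, ⟨?_, ?_⟩⟩ <;> linarith

end Taylor

/-! ### Calculus of approximate parity. -/

section Parity

variable {E : Type*} [NormedAddCommGroup E]

/-- On the unit ball `a` is of order `k`, and it has the parity of `k` up to order `k + 1`. -/
def HasParity (k : ℕ) (K : ℝ) (a : E → ℝ) : Prop :=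
  ∀ w, ‖w‖ ≤ 1 → |a w| ≤ K * ‖w‖ ^ k ∧ |a w - (-1) ^ k * a (-w)| ≤ K * ‖w‖ ^ (k + 1)

theorem HasParity.add {k : ℕ} {K L : ℝ} {a b : E → ℝ} (ha : HasParity k K a)
    (hb : HasParity k L b) : HasParity k (K + L) fun w => a w + b w := by
  intro w hw
  obtain ⟨a1, a2⟩ := ha w hw
  obtain ⟨b1, b2⟩ := hb w hw
  constructor
  · refine (abs_add_le _ _).trans ?_
    rw [add_mul]
    exact add_le_add a1 b1
  · have : a w + b w - (-1) ^ k * (a (-w) + b (-w)) =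
        (a w - (-1) ^ k * a (-w)) + (b w - (-1) ^ k * b (-w)) := by ring
    rw [this]
    refine (abs_add_le _ _).trans ?_
    rw [add_mul]
    exact add_le_add a2 b2

/-- Orders add and signs multiply. The discrete product rule leaves two error terms, each of one
order more than the product, whence the factor 2. -/
theorem HasParity.mul {j k : ℕ} {K L : ℝ} {a b : E → ℝ} (hK : 0 ≤ K) (ha : HasParity j K a)
    (hb : HasParity k L b) (hL : 0 ≤ L) : HasParity (j + k) (2 * (K * L)) fun w => a w * b w := by
  intro w hw
  obtain ⟨a1, a2⟩ := ha w hw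
  obtain ⟨b1, b2⟩ := hb w hw
  have a3 := (ha (-w) (by rwa [norm_neg])).1
  rw [norm_neg] at a3
  have w0 := norm_nonneg w
  constructor
  · rw [abs_mul]
    calc |a w| * |b w| ≤ (K * ‖w‖ ^ j) * (L * ‖w‖ ^ k) := by gcongr
      _ = (K * L) * ‖w‖ ^ (j + k) := by ring
      _ ≤ 2 * (K * L) * ‖w‖ ^ (j + k) := by
        exact mul_le_mul_of_nonneg_right (by nlinarith [mul_nonneg hK hL]) (by positivity)
  · have : a w * b w - (-1) ^ (j + k) * (a (-w) * b (-w)) =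
        (a w - (-1) ^ j * a (-w)) * b w + (-1) ^ j * (a (-w)) * (b w - (-1) ^ k * b (-w)) := by ring
    rw [this]
    refine (abs_add_le _ _).trans ?_
    rw [abs_mul, abs_mul, abs_mul, abs_pow, abs_neg, abs_one, one_pow, one_mul]
    calc _ ≤ (K * ‖w‖ ^ (j + 1)) * (L * ‖w‖ ^ k) + (K * ‖w‖ ^ j) * (L * ‖w‖ ^ (k + 1)) := by gcongr
      _ = _ := by ring

theorem hasParity_const (c : ℝ) : HasParity 0 |c| fun _ : E => c := by
  intro w _
  simp
  positivity

theorem HasParity.mono {k : ℕ} {K L : ℝ} {a : E → ℝ} (ha : HasParity k K a) (hKL : K ≤ L) :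
    HasParity k L a := by
  intro w hw
  obtain ⟨a1, a2⟩ := ha w hw
  exact ⟨a1.trans (by gcongr), a2.trans (by gcongr)⟩

variable [NormedSpace ℝ E]

/-- The parity defect of `g (u + w)` is a first difference over `2w`; that of `g (u + w) - g u` is
the symmetric second difference. Two derivatives therefore suffice, which is what `f` has. -/
theorem exists_hasParity_difference {g : E → ℝ} (hg : ContDiff ℝ 2 g) (hc : HasCompactSupport g) :
    ∃ C : ℝ, 0 < C ∧ ∀ u, HasParity 0 C (fun w => g (u + w)) ∧
      HasParity 1 C (fun w => g (u + w) - g u) := by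
  obtain ⟨C, hC, hb⟩ := exists_difference_bounds hg hc
  refine ⟨2 * C, by positivity, fun u => ⟨fun w hw => ?_, fun w hw => ?_⟩⟩
  · have h1 := (hb u w).2.1
    have h2 := (hb u (-w)).2.1
    rw [norm_neg] at h2
    have h3 := (hb (u + w) 0).1
    constructor
    · simp only [pow_zero, mul_one]; linarith
    · simp only [pow_zero, one_mul, zero_add, pow_one]
      rw [abs_le] at *
      constructor <;> linarith [h1.1, h1.2, h2.1, h2.2]
  · have h1 := (hb u w).2.1
    have h3 := (hb u w).2.2
    constructor
    · have : 0 ≤ C * ‖w‖ := by positivity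
      simp only [pow_one]; linarith
    · have : 0 ≤ C * ‖w‖ ^ 2 := by positivity
      have e : g (u + w) - g u - (-1) ^ 1 * (g (u + -w) - g u) =
        g (u + w) + g (u - w) - 2 * g u := by rw [← sub_eq_add_neg]; ring
      rw [e]
      simp only [Nat.reduceAdd]
      linarith

theorem exists_hasParity_defect {h : E → ℝ} (hh : ContDiff ℝ 4 h) (hc : HasCompactSupport h) :
    ∃ C : ℝ, 0 < C ∧ ∀ u, HasParity 2 C (sourceDefect h u) ∧ HasParity 2 C (targetDefect h u) ∧
      HasParity 3 C (fun w => sourceDefect h u w + targetDefect h u w) := by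
  obtain ⟨C, hC, hb⟩ := exists_defect_bounds hh hc
  refine ⟨C, hC, fun u => ⟨fun w hw => ?_, fun w hw => ?_, fun w hw => ?_⟩⟩
  · obtain ⟨h1, -, h3, -, -, -⟩ := hb u w hw
    exact ⟨h1, by simpa using h3⟩
  · obtain ⟨-, h2, -, h4, -, -⟩ := hb u w hw
    exact ⟨h2, by simpa using h4⟩
  · obtain ⟨-, -, -, -, h5, h6⟩ := hb u w hw
    refine ⟨h5, ?_⟩
    have e : (-1 : ℝ) ^ 3 = -1 := by norm_num
    rw [e, neg_one_mul, sub_neg_eq_add]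
    exact h6

end Parity

/-! ### The cubic estimate in the parameter plane. -/

section LocalEstimate

theorem integrable_norm_div_one_add_norm_pow :
    Integrable fun w : E2 => ‖w‖ / (1 + ‖w‖) ^ 4 := by
  have h1 : Integrable fun w : E2 => (1 + ‖w‖) ^ (-(3 : ℝ)) :=
    integrable_one_add_norm (by rw [finrank_euclideanSpace_fin]; norm_num)
  refine h1.mono' (by
    refine Continuous.aestronglyMeasurable ?_
    exact continuous_norm.div (by fun_prop) fun w => by positivity) (ae_of_all _ fun w => ?_)
  rw [Real.norm_eq_abs, abs_of_nonneg (by positivity), Real.rpow_neg (by positivity),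
    show (3 : ℝ) = ((3 : ℕ) : ℝ) by norm_num, Real.rpow_natCast, div_le_iff₀ (by positivity)]
  have : ((1 + ‖w‖) ^ 3)⁻¹ * (1 + ‖w‖) ^ 4 = 1 + ‖w‖ := by field_simp
  rw [this]
  linarith

theorem norm_div_one_add_eq {δ : ℝ} (hδ : 0 < δ) (w : E2) :
    ‖w‖ / (1 + ‖w‖ / δ) ^ 4 = δ * (‖δ⁻¹ • w‖ / (1 + ‖δ⁻¹ • w‖) ^ 4) := by
  rw [norm_smul, norm_inv, Real.norm_eq_abs, abs_of_pos hδ]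
  field_simp

theorem integrable_norm_div_scaled {δ : ℝ} (hδ : 0 < δ) :
    Integrable fun w : E2 => ‖w‖ / (1 + ‖w‖ / δ) ^ 4 := by
  simp_rw [norm_div_one_add_eq hδ]
  exact (integrable_norm_div_one_add_norm_pow.comp_smul (inv_ne_zero hδ.ne')).const_mul δ

/-- One power of `δ` comes from the factor `‖w‖`, two from the area scaling of the plane. -/
theorem integral_norm_div_scaled {δ : ℝ} (hδ : 0 < δ) :
    ∫ w : E2, ‖w‖ / (1 + ‖w‖ / δ) ^ 4 = δ ^ 3 * ∫ w : E2, ‖w‖ / (1 + ‖w‖) ^ 4 := by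
  simp_rw [norm_div_one_add_eq hδ]
  rw [integral_const_mul, integral_comp_inv_smul (μ := volume)
    (fun w : E2 => ‖w‖ / (1 + ‖w‖) ^ 4), finrank_euclideanSpace_fin, smul_eq_mul,
    abs_of_pos (by positivity)]
  ring

/-- The distance of two points of the graph of `h`. -/
noncomputable def graphDist {E : Type*} [NormedAddCommGroup E] (h : E → ℝ) (u w : E) : ℝ :=
  √(‖w‖ ^ 2 + (h (u + w) - h u) ^ 2)

theorem norm_le_graphDist {E : Type*} [NormedAddCommGroup E] (h : E → ℝ) (u w : E) :
    ‖w‖ ≤ graphDist h u w :=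
  Real.le_sqrt_of_sq_le (by linarith [sq_nonneg (h (u + w) - h u)])

/-- The squares of the distances differ by the difference of the two height increments, `O(‖w‖)`,
times their sum, a second difference `O(‖w‖²)`. Divide by the sum of the distances, at least `2
‖w‖`. -/
theorem abs_graphDist_sub_le {E : Type*} [NormedAddCommGroup E] {h : E → ℝ} {u w : E}
    {C : ℝ} (hC : 0 ≤ C) (hw : w ≠ 0) (h1 : |h (u + w) - h u| ≤ C * ‖w‖)
    (h1' : |h (u + -w) - h u| ≤ C * ‖w‖)
    (h2 : |h (u + w) - h u + (h (u + -w) - h u)| ≤ C * ‖w‖ ^ 2) :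
    |graphDist h u w - graphDist h u (-w)| ≤ C ^ 2 * ‖w‖ ^ 2 := by
  have hw0 : 0 < ‖w‖ := norm_pos_iff.2 hw
  have a1 := norm_le_graphDist h u w
  have a2 := norm_le_graphDist h u (-w)
  rw [norm_neg] at a2
  set r := graphDist h u w with hr
  set r' := graphDist h u (-w) with hr'
  have e1 : r ^ 2 = ‖w‖ ^ 2 + (h (u + w) - h u) ^ 2 := Real.sq_sqrt (by positivity)
  have e2 : r' ^ 2 = ‖w‖ ^ 2 + (h (u + -w) - h u) ^ 2 := by
    rw [hr', graphDist, Real.sq_sqrt (by positivity), norm_neg]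
  have e3 : |r - r'| * (r + r') = |h (u + w) - h u - (h (u + -w) - h u)| *
      |h (u + w) - h u + (h (u + -w) - h u)| := by
    rw [← abs_mul]
    conv_lhs => rw [← abs_of_nonneg (show 0 ≤ r + r' by linarith), ← abs_mul]
    congr 1
    nlinarith
  have e4 : |h (u + w) - h u - (h (u + -w) - h u)| ≤ 2 * C * ‖w‖ := by
    refine (abs_sub _ _).trans ?_
    linarith
  have e5 : |r - r'| * (2 * ‖w‖) ≤ (2 * C * ‖w‖) * (C * ‖w‖ ^ 2) := by
    calc |r - r'| * (2 * ‖w‖) ≤ |r - r'| * (r + r') := by gcongr; linarith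
      _ ≤ _ := by rw [e3]; gcongr
  have e6 : (2 * C * ‖w‖) * (C * ‖w‖ ^ 2) = (C ^ 2 * ‖w‖ ^ 2) * (2 * ‖w‖) := by ring
  rw [e6] at e5
  exact le_of_mul_le_mul_right e5 (by positivity)

/-- A density that is odd and of third order up to fourth order terms contributes an error of
third order. -/
theorem exists_integral_errorKernel_bound {h : E2 → ℝ} (hh : ContDiff ℝ 2 h)
    (hc : HasCompactSupport h) {K : ℝ} (hK : 0 ≤ K) :
    ∃ C : ℝ, 0 ≤ C ∧ ∀ (δ : ℝ), 0 < δ → ∀ R ≤ 1, ∀ (u : E2) (a : E2 → ℝ), HasParity 3 K a →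
      |∫ w in Metric.ball 0 R, a w * errorKernel δ (graphDist h u w)| ≤ C * δ ^ 3 := by
  obtain ⟨A, hA, hpar⟩ := exists_hasParity_difference hh hc
  obtain ⟨B, hB, hker⟩ := exists_errorKernel_bounds
  have hI0 : 0 ≤ ∫ w : E2, ‖w‖ / (1 + ‖w‖) ^ 4 := integral_nonneg fun w => by positivity
  refine ⟨K * B * (1 + A ^ 2) * ∫ w : E2, ‖w‖ / (1 + ‖w‖) ^ 4, by positivity,
    fun δ hδ R hR u a ha => ?_⟩
  set F : E2 → ℝ := fun w => a w * errorKernel δ (graphDist h u w) with hF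
  have hsymm : ∫ w in Metric.ball 0 R, F (-w) = ∫ w in Metric.ball 0 R, F w := by
    have h1 := (Measure.measurePreserving_neg (volume : Measure E2)).setIntegral_preimage_emb
      (MeasurableEquiv.neg E2).measurableEmbedding F (Metric.ball 0 R)
    have h2 : (Neg.neg : E2 → E2) ⁻¹' Metric.ball 0 R = Metric.ball 0 R := by
      ext w; simp
    rw [h2] at h1
    exact h1
  have hpoint : ∀ w ∈ Metric.ball (0 : E2) R, ‖F w + F (-w)‖ ≤
      K * B * (1 + A ^ 2) * (‖w‖ / (1 + ‖w‖ / δ) ^ 4) := by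
    intro w hw
    have hw1 : ‖w‖ ≤ 1 := (mem_ball_zero_iff.1 hw).le.trans hR
    obtain ⟨a1, a2⟩ := ha w hw1
    have a3 := (ha (-w) (by rwa [norm_neg])).1
    rw [norm_neg] at a3
    rcases eq_or_ne w 0 with rfl | hw0
    · have : a 0 = 0 := by simpa using a1
      simp [hF, this]
    have hwpos : 0 < ‖w‖ := norm_pos_iff.2 hw0
    obtain ⟨k1, k2⟩ := hker δ ‖w‖ hδ hwpos
    have r1 := norm_le_graphDist h u w
    have r2 := norm_le_graphDist h u (-w)
    rw [norm_neg] at r2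
    have b1 := k1 _ r1
    have b2 := k2 _ r2 _ r1
    obtain ⟨d1, d2⟩ := (hpar u).2 w hw1
    have d3 := ((hpar u).2 (-w) (by rwa [norm_neg])).1
    rw [norm_neg] at d3
    have hdist := abs_graphDist_sub_le hA.le hw0 (by simpa using d1) (by simpa using d3)
      (by
        rw [show h (u + w) - h u + (h (u + -w) - h u) =
          h (u + w) - h u - (-1) ^ 1 * (h (u + -w) - h u) by ring]
        exact d2)
    -- The first term uses the near-oddness of `a`, the second the near-evenness of the distance.
    -- Each is of order `‖w‖ / (1 + ‖w‖ / δ) ^ 4`.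
    have e : F w + F (-w) = (a w - (-1) ^ 3 * a (-w)) * errorKernel δ (graphDist h u w) +
        a (-w) * (errorKernel δ (graphDist h u (-w)) - errorKernel δ (graphDist h u w)) := by
      simp only [hF]; ring
    rw [e]
    refine (norm_add_le _ _).trans ?_
    rw [norm_mul, norm_mul, Real.norm_eq_abs, Real.norm_eq_abs, Real.norm_eq_abs, Real.norm_eq_abs]
    rw [abs_sub_comm] at hdist
    have hpos : 0 < 1 + ‖w‖ / δ := by positivity
    calc _ ≤ (K * ‖w‖ ^ (3 + 1)) * (B / (‖w‖ ^ 3 * (1 + ‖w‖ / δ) ^ 4)) +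
          (K * ‖w‖ ^ 3) * (B / (‖w‖ ^ 4 * (1 + ‖w‖ / δ) ^ 4) * (A ^ 2 * ‖w‖ ^ 2)) := by
          gcongr
          exact b2.trans (by gcongr)
      _ = _ := by
        generalize 1 + ‖w‖ / δ = q at hpos
        field_simp
        ring
  -- Integrability of `F` is not assumed; without it the integral is zero by convention.
  by_cases hint : IntegrableOn F (Metric.ball 0 R)
  · have hint' : IntegrableOn (fun w => F (-w)) (Metric.ball 0 R) := by
      have h1 := ((Measure.measurePreserving_neg (volume : Measure E2)).integrableOn_comp_preimage
        (MeasurableEquiv.neg E2).measurableEmbedding (f := F) (s := Metric.ball 0 R)).2 hint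
      have h2 : (Neg.neg : E2 → E2) ⁻¹' Metric.ball 0 R = Metric.ball 0 R := by
        ext w; simp
      rw [h2] at h1
      exact h1
    have hsum : 2 * ∫ w in Metric.ball 0 R, F w = ∫ w in Metric.ball 0 R, (F w + F (-w)) := by
      rw [integral_add hint hint', hsymm]; ring
    have hbint : Integrable fun w : E2 =>
        K * B * (1 + A ^ 2) * (‖w‖ / (1 + ‖w‖ / δ) ^ 4) :=
      (integrable_norm_div_scaled hδ).const_mul _
    have hle := norm_integral_le_of_norm_le (hbint.integrableOn (s := Metric.ball 0 R))
      (ae_restrict_of_forall_mem measurableSet_ball hpoint)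
    have hle' : ∫ w in Metric.ball (0 : E2) R, K * B * (1 + A ^ 2) * (‖w‖ / (1 + ‖w‖ / δ) ^ 4) ≤
        ∫ w : E2, K * B * (1 + A ^ 2) * (‖w‖ / (1 + ‖w‖ / δ) ^ 4) :=
      setIntegral_le_integral hbint (ae_of_all _ fun w => by positivity)
    rw [← hsum, norm_mul] at hle
    have hval : ∫ w : E2, K * B * (1 + A ^ 2) * (‖w‖ / (1 + ‖w‖ / δ) ^ 4) =
        K * B * (1 + A ^ 2) * (δ ^ 3 * ∫ w : E2, ‖w‖ / (1 + ‖w‖) ^ 4) := by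
      rw [integral_const_mul, integral_norm_div_scaled hδ]
    rw [hval] at hle'
    have h0 := abs_nonneg (∫ w in Metric.ball 0 R, F w)
    simp only [Real.norm_eq_abs, abs_two] at hle
    linarith
  · rw [integral_undef hint, abs_zero]
    positivity

theorem contDiff_areaElement {h : E2 → ℝ} {n : ℕ∞ω} {m : ℕ∞ω} (hh : ContDiff ℝ n h)
    (hmn : m + 1 ≤ n) : ContDiff ℝ m (areaElement h) := by
  unfold areaElement gradient
  refine ContDiff.sqrt ?_ fun u => by positivity
  refine contDiff_const.add (ContDiff.norm_sq ℝ ?_)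
  exact (InnerProductSpace.toDual ℝ E2).symm.toContinuousLinearEquiv.contDiff.comp
    (hh.fderiv_right hmn)

/-- Where the derivative of `h` vanishes the area element is 1, so subtracting 1 makes the
difference bounds for compactly supported functions applicable. -/
theorem hasCompactSupport_areaElement_sub_one {h : E2 → ℝ} (hc : HasCompactSupport h) :
    HasCompactSupport fun u => areaElement h u - 1 := by
  refine (hc.fderiv (𝕜 := ℝ)).mono' ?_
  refine Set.Subset.trans ?_ subset_closure
  intro u hu
  contrapose! hu
  simp only [Function.mem_support, not_not] at hu ⊢
  simp [areaElement, gradient, hu]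

/-- The densities of both errors are odd of third order up to fourth order terms. -/
theorem exists_hasParity_densities {h g : E2 → ℝ} (hh : ContDiff ℝ 4 h)
    (hc : HasCompactSupport h) (hg : ContDiff ℝ 2 g) (hgc : HasCompactSupport g) :
    ∃ C : ℝ, 0 ≤ C ∧ ∀ u,
      HasParity 3 C (fun w => g (u + w) * (sourceDefect h u w +
        targetDefect h u w * (areaElement h (u + w) / areaElement h u))) ∧
      HasParity 3 C (fun w => (g (u + w) - g u) * sourceDefect h u w) := by
  obtain ⟨A, hA, hgA⟩ := exists_hasParity_difference hg hgc
  obtain ⟨B, hB, hhB⟩ := exists_hasParity_defect hh hc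
  have hJ : ContDiff ℝ 2 fun u => areaElement h u - 1 :=
    (contDiff_areaElement hh (by norm_num)).sub contDiff_const
  obtain ⟨D, hD, hJD⟩ := exists_hasParity_difference hJ (hasCompactSupport_areaElement_sub_one hc)
  set M := max (2 * (A * (B + 2 * (B * (2 * (D * 1)))))) (2 * (A * B)) with hM
  refine ⟨M, le_max_of_le_right (by positivity), fun u => ⟨?_, ?_⟩⟩
  · have h1 : HasParity 0 1 fun _ : E2 => (areaElement h u)⁻¹ := by
      refine (hasParity_const _).mono ?_
      rw [abs_of_pos (inv_pos.2 (areaElement_pos h u))]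
      exact inv_le_one_of_one_le₀ (one_le_areaElement h u)
    -- The target term is split as `targetDefect + targetDefect * (J(u + w) - J(u)) / J(u)`. The
    -- relative change of the area element `J` is odd of first order, so the last product is again
    -- of third order.
    have h2 := (hJD u).2.mul hD.le h1 zero_le_one
    have h3 := (hhB u).2.1.mul hB.le h2 (by positivity)
    have h4 := (hgA u).1.mul hA.le ((hhB u).2.2.add h3) (by positivity)
    have h5 := h4.mono (le_max_left _ (2 * (A * B)))
    rw [zero_add] at h5
    convert h5 using 2 with w
    have := (areaElement_pos h u).ne'
    field_simp
    ring
  · have h4 := (hgA u).2.mul hA.le (hhB u).1 hB.le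
    exact h4.mono (le_max_right _ _)

end LocalEstimate

/-! ### Graph charts of the boundary. -/

section Chart

/-- Replacing local functions by global compactly supported ones makes the Lipschitz and Taylor
constants uniform over the whole plane. -/
theorem exists_contDiff_cutoff {g : E2 → ℝ} {n : ℕ∞} {ε : ℝ} (hε : 0 < ε)
    (hg : ∀ u ∈ Metric.ball (0 : E2) ε, ContDiffAt ℝ n g u) :
    ∃ k : E2 → ℝ, ContDiff ℝ n k ∧ HasCompactSupport k ∧
      ∀ u ∈ Metric.ball (0 : E2) (ε / 2), k u = g u := by
  let χ : ContDiffBump (0 : E2) := ⟨ε / 2, 3 * ε / 4, by linarith, by linarith⟩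
  have hts : tsupport (fun u => χ u * g u) ⊆ tsupport χ := tsupport_mul_subset_left
  have hχ : tsupport χ = Metric.closedBall 0 (3 * ε / 4) := χ.tsupport_eq
  refine ⟨fun u => χ u * g u, contDiff_iff_contDiffAt.2 fun u => ?_,
    χ.hasCompactSupport.mul_right, fun u hu => ?_⟩
  · by_cases hu : u ∈ tsupport fun u => χ u * g u
    swap
    · exact contDiffAt_const.congr_of_eventuallyEq (notMem_tsupport_iff_eventuallyEq.1 hu)
    have h1 : u ∈ Metric.closedBall (0 : E2) (3 * ε / 4) := hχ ▸ hts hu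
    have h2 : u ∈ Metric.ball (0 : E2) ε := by
      rw [mem_closedBall_zero_iff] at h1
      rw [mem_ball_zero_iff]
      linarith
    exact χ.contDiffAt.mul (hg u h2)
  · have : χ u = 1 := χ.one_of_mem_closedBall (Metric.ball_subset_closedBall hu)
    simp [this]

theorem Frame.norm_le_norm_add_smul (Φ : Frame) (v : E2) (t : ℝ) :
    ‖v‖ ≤ ‖Φ.plane v + t • Φ.normal‖ := by
  refine le_of_sq_le_sq ?_ (norm_nonneg _)
  rw [Φ.norm_add_smul_sq]
  linarith [sq_nonneg t]

theorem Frame.abs_le_norm_add_smul (Φ : Frame) (v : E2) (t : ℝ) :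
    |t| ≤ ‖Φ.plane v + t • Φ.normal‖ := by
  refine le_of_sq_le_sq ?_ (norm_nonneg _)
  rw [Φ.norm_add_smul_sq, sq_abs]
  linarith [sq_nonneg ‖v‖]

theorem Frame.add_smul_injective (Φ : Frame) {v w : E2} {s t : ℝ}
    (h : Φ.plane v + s • Φ.normal = Φ.plane w + t • Φ.normal) : v = w ∧ s = t := by
  have h0 : Φ.plane (v - w) + (s - t) • Φ.normal = 0 := by
    rw [map_sub, sub_smul]
    have := sub_eq_zero.2 h
    rw [← this]
    abel
  have h1 := Φ.norm_le_norm_add_smul (v - w) (s - t)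
  have h2 := Φ.abs_le_norm_add_smul (v - w) (s - t)
  rw [h0, norm_zero] at h1 h2
  exact ⟨sub_eq_zero.1 (norm_le_zero_iff.1 h1), sub_eq_zero.1 (abs_nonpos_iff.1 h2)⟩

theorem Frame.exists_eq_add_smul (Φ : Frame) (z : E3) :
    ∃ (v : E2) (t : ℝ), z = Φ.plane v + t • Φ.normal := by
  let L : E2 × ℝ →ₗ[ℝ] E3 := Φ.plane.toLinearMap.coprod (LinearMap.toSpanSingleton ℝ E3 Φ.normal)
  have hinj : Function.Injective L := by
    rintro ⟨v, s⟩ ⟨w, t⟩ h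
    obtain ⟨h1, h2⟩ := Φ.add_smul_injective (v := v) (w := w) (s := s) (t := t) (by simpa [L] using h)
    rw [h1, h2]
  have hsurj := (LinearMap.injective_iff_surjective_of_finrank_eq_finrank (f := L) (by simp)).1 hinj
  obtain ⟨⟨v, t⟩, h⟩ := hsurj z
  exact ⟨v, t, by simpa [L] using h.symm⟩

theorem exists_frame (p n : E3) (hn : ‖n‖ = 1) : ∃ Φ : Frame, Φ.origin = p ∧ Φ.normal = n := by
  have hn0 : n ≠ 0 := norm_ne_zero_iff.1 (by rw [hn]; exact one_ne_zero)
  have : Fact (finrank ℝ E3 = 2 + 1) := ⟨by simp⟩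
  let b := OrthonormalBasis.fromOrthogonalSpanSingleton (𝕜 := ℝ) 2 hn0
  refine ⟨⟨p, (ℝ ∙ n)ᗮ.subtypeₗᵢ.comp b.repr.symm.toLinearIsometry, n, hn, fun v => ?_⟩, rfl, rfl⟩
  rw [real_inner_comm]
  exact Submodule.mem_orthogonal_singleton_iff_inner_right.1 (b.repr.symm v).2

/-- At a zero of `ρ`, points slightly displaced along `-∇ ρ` have `ρ < 0` and so lie in `Ω`, while
the zero itself does not. -/
theorem mem_frontier_iff_of_isLocalDefiningFunction {Ω U : Set E3} {ρ : E3 → ℝ} (hΩ : IsOpen Ω)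
    (h : IsLocalDefiningFunction Ω U ρ) {x : E3} (hx : x ∈ U) : x ∈ frontier Ω ↔ ρ x = 0 := by
  refine ⟨fun hf => h.eq_zero hΩ hf hx, fun h0 => ?_⟩
  rw [hΩ.frontier_eq]
  refine ⟨?_, fun hxΩ => ?_⟩
  · set v := ∇ ρ x with hv
    have hd : HasFDerivAt ρ (fderiv ℝ ρ x) x :=
      ((h.contDiffOn.contDiffAt (h.isOpen.mem_nhds hx)).differentiableAt (by simp)).hasFDerivAt
    have hl := hd.hasLineDerivAt (-v)
    have hval : fderiv ℝ ρ x (-v) < 0 := by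
      rw [map_neg, ← inner_gradient_left, ← hv, real_inner_self_eq_norm_sq]
      have : 0 < ‖v‖ := norm_pos_iff.2 (h.gradient_ne_zero x hx)
      nlinarith
    have ht := (hl.tendsto_slope_zero_right).eventually (gt_mem_nhds hval)
    rw [mem_closure_iff_frequently]
    have hc : Tendsto (fun t : ℝ => x + t • (-v)) (𝓝[>] 0) (𝓝 x) := by
      have : Continuous fun t : ℝ => x + t • (-v) := by fun_prop
      have h1 := this.tendsto 0
      simp only [zero_smul, add_zero] at h1
      exact h1.mono_left nhdsWithin_le_nhds
    refine hc.frequently (Eventually.frequently ?_)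
    filter_upwards [ht, hc.eventually (h.isOpen.mem_nhds hx), self_mem_nhdsWithin] with t h1 h2 h3
    rw [h0, sub_zero, smul_eq_mul] at h1
    have h4 : ρ (x + t • (-v)) < 0 := by
      by_contra hcon
      push Not at hcon
      have : (0 : ℝ) < t := h3
      have := mul_nonneg (inv_nonneg.2 this.le) hcon
      linarith
    have h5 : x + t • (-v) ∈ {y ∈ U | ρ y < 0} := ⟨h2, h4⟩
    rw [← h.inter_eq] at h5
    exact h5.1
  · have : x ∈ Ω ∩ U := ⟨hxΩ, hx⟩
    rw [h.inter_eq] at this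
    exact absurd this.2 (by rw [h0]; exact lt_irrefl 0)

/-- Near a point `p` the boundary of `Ω` is the graph of `h` over the plane of the frame `Φ`. -/
structure IsGraphChart (Ω : Set E3) (p : E3) (Φ : Frame) (h : E2 → ℝ) (r : ℝ) : Prop where
  pos : 0 < r
  origin_eq : Φ.origin = p
  contDiff : ContDiff ℝ 4 h
  hasCompactSupport : HasCompactSupport h
  mem_frontier_iff : ∀ x ∈ Metric.ball p r, x ∈ frontier Ω ↔ x ∈ range (Φ.graph h)
  outwardNormal_graph : ∀ u, Φ.graph h u ∈ Metric.ball p r →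
    outwardNormal Ω (Φ.graph h u) = (areaElement h u)⁻¹ • (Φ.normal - Φ.plane (∇ h u))

theorem IsGraphChart.mono {Ω : Set E3} {p : E3} {Φ : Frame} {h : E2 → ℝ} {r s : ℝ}
    (hc : IsGraphChart Ω p Φ h r) (hs : 0 < s) (hsr : s ≤ r) : IsGraphChart Ω p Φ h s :=
  ⟨hs, hc.origin_eq, hc.contDiff, hc.hasCompactSupport,
    fun x hx => hc.mem_frontier_iff x (Metric.ball_subset_ball hsr hx),
    fun u hu => hc.outwardNormal_graph u (Metric.ball_subset_ball hsr hu)⟩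

/-- Differentiating `ρ = 0` along the graph forces the component of `∇ ρ` in the plane to be `-∇ h`
times its normal component. -/
theorem gradient_eq_smul_of_graph {ρ : E3 → ℝ} {Φ : Frame} {h : E2 → ℝ} {u : E2}
    (hρ : DifferentiableAt ℝ ρ (Φ.graph h u)) (hh : DifferentiableAt ℝ h u)
    (h0 : (fun v => ρ (Φ.graph h v)) =ᶠ[𝓝 u] fun _ => 0) :
    ∇ ρ (Φ.graph h u) =
      inner ℝ (∇ ρ (Φ.graph h u)) Φ.normal • (Φ.normal - Φ.plane (∇ h u)) := by
  have h1 := hρ.hasFDerivAt.comp u (Φ.hasFDerivAt_graph hh)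
  have h2 : HasFDerivAt (ρ ∘ Φ.graph h) (0 : E2 →L[ℝ] ℝ) u :=
    (hasFDerivAt_const (0 : ℝ) u).congr_of_eventuallyEq h0
  have h3 := h1.unique h2
  obtain ⟨a, b, hab⟩ := Φ.exists_eq_add_smul (∇ ρ (Φ.graph h u))
  have hb : inner ℝ (∇ ρ (Φ.graph h u)) Φ.normal = b := by
    have := Φ.inner_add_smul a 0 b 1
    rw [hab]
    simpa using this
  have h4 : ∀ v, inner ℝ (a + b • ∇ h u) v = (0 : ℝ) := by
    intro v
    have h5 := congrArg (fun L : E2 →L[ℝ] ℝ => L v) h3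
    have h6 : fderiv ℝ ρ (Φ.graph h u) (Φ.plane v + (fderiv ℝ h u v) • Φ.normal) = 0 := by
      simpa using h5
    rw [← inner_gradient_left, hab, Φ.inner_add_smul, ← inner_gradient_left] at h6
    rw [inner_add_left, real_inner_smul_left]
    exact h6
  have h7 : a + b • ∇ h u = 0 := by
    have := h4 (a + b • ∇ h u)
    exact inner_self_eq_zero.1 this
  rw [hb, hab, eq_neg_of_add_eq_zero_left h7, map_neg, map_smul, smul_sub]
  abel

theorem norm_normal_sub_plane_gradient (Φ : Frame) (h : E2 → ℝ) (u : E2) :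
    ‖Φ.normal - Φ.plane (∇ h u)‖ = areaElement h u := by
  refine (sq_eq_sq₀ (norm_nonneg _) (areaElement_pos h u).le).1 ?_
  have := Φ.norm_add_smul_sq (-∇ h u) 1
  rw [map_neg, one_smul, neg_add_eq_sub, norm_neg] at this
  rw [this, areaElement_sq]
  ring

theorem isInvertible_of_apply_one_ne_zero {L : ℝ →L[ℝ] ℝ} (hL : L 1 ≠ 0) : L.IsInvertible := by
  refine ⟨ContinuousLinearEquiv.unitsEquivAut ℝ (Units.mk0 (L 1) hL), ?_⟩
  ext
  simp

/-- The frame normal is the normalized gradient of `ρ` at `p`, so the normal derivative of `ρ` there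
is `‖∇ ρ p‖ ≠ 0` and the implicit function theorem solves `ρ = 0` for the height. The result is cut
off to become global. -/
theorem exists_isGraphChart {Ω : Set E3} (hΩ : IsBoundedSmoothDomain Ω) {p : E3}
    (hp : p ∈ frontier Ω) : ∃ (Φ : Frame) (h : E2 → ℝ) (r : ℝ), IsGraphChart Ω p Φ h r := by
  obtain ⟨U, ρ, hdef, hpU⟩ := hΩ.smooth_boundary p hp
  have hgp : 0 < ‖∇ ρ p‖ := norm_pos_iff.2 (hdef.gradient_ne_zero p hpU)
  set n := ‖∇ ρ p‖⁻¹ • ∇ ρ p with hn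
  have hn1 : ‖n‖ = 1 := norm_smul_inv_norm (𝕜 := ℝ) (hdef.gradient_ne_zero p hpU)
  obtain ⟨Φ, hΦp, hΦn⟩ := exists_frame p n hn1
  set ι : E2 × ℝ → E3 := fun q => p + (Φ.plane q.1 + q.2 • n) with hι
  have hι0 : ι (0, 0) = p := by simp [hι]
  have hιc : ContDiff ℝ ∞ ι := by
    have h1 : ContDiff ℝ ∞ fun q : E2 × ℝ => Φ.plane q.1 :=
      Φ.plane.toContinuousLinearMap.contDiff.comp contDiff_fst
    exact contDiff_const.add (h1.add (contDiff_snd.smul contDiff_const))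
  have hρsmooth : ∀ x ∈ U, ContDiffAt ℝ 4 ρ x := fun x hx =>
    (hdef.contDiffOn.contDiffAt (hdef.isOpen.mem_nhds hx)).of_le (by norm_cast)
  have hΨ : ContDiffAt ℝ 4 (ρ ∘ ι) (0, 0) :=
    ContDiffAt.comp _ (by rw [hι0]; exact hρsmooth p hpU)
      (hιc.contDiffAt.of_le (by norm_cast))
  have hpartial : (fderiv ℝ (ρ ∘ ι) (0, 0) ∘L .inr ℝ E2 ℝ).IsInvertible := by
    refine isInvertible_of_apply_one_ne_zero ?_
    have h1 : HasFDerivAt (ρ ∘ ι) (fderiv ℝ (ρ ∘ ι) (0, 0)) (0, 0) :=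
      (hΨ.differentiableAt (by norm_num)).hasFDerivAt
    have h2 : HasDerivAt (fun t : ℝ => ((0 : E2), t)) ((0 : E2), (1 : ℝ)) 0 :=
      (hasDerivAt_const _ _).prodMk (hasDerivAt_id 0)
    have h3 := h1.comp_hasDerivAt (0 : ℝ) h2
    have h4 : HasDerivAt (fun t : ℝ => ρ (p + t • n)) (inner ℝ (∇ ρ p) n) 0 := by
      have h5 : HasDerivAt (fun t : ℝ => p + t • n) n 0 := by
        simpa using ((hasDerivAt_id (0 : ℝ)).smul_const n).const_add p
      have h6 : HasFDerivAt ρ (fderiv ℝ ρ p) (p + (0 : ℝ) • n) := by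
        simpa using ((hρsmooth p hpU).differentiableAt (by norm_num)).hasFDerivAt
      have h7 := h6.comp_hasDerivAt (0 : ℝ) h5
      rw [← inner_gradient_left] at h7
      exact h7
    have h8 : (ρ ∘ ι) ∘ (fun t : ℝ => ((0 : E2), t)) = fun t => ρ (p + t • n) := by
      ext t; simp [hι]
    rw [h8] at h3
    have h9 := h3.unique h4
    simp only [ContinuousLinearMap.comp_apply, ContinuousLinearMap.inr_apply]
    rw [h9, hn, real_inner_smul_right, real_inner_self_eq_norm_sq]
    positivity
  set ψ := hΨ.implicitFunction (by norm_num) hpartial with hψ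
  have hψC : ContDiffAt ℝ 4 ψ 0 := hΨ.contDiffAt_implicitFunction (by norm_num) hpartial
  have hψiff : ∀ᶠ q : E2 × ℝ in 𝓝 (0, 0), (ρ ∘ ι) q = (ρ ∘ ι) (0, 0) ↔ ψ q.1 = q.2 :=
    hΨ.eventually_apply_eq_iff_implicitFunction (by norm_num) hpartial
  have hρp : ρ p = 0 := hdef.eq_zero hΩ.isOpen hp hpU
  obtain ⟨ε, hε, hεball⟩ := Metric.eventually_nhds_iff_ball.1
    (hψC.eventually (by simp))
  obtain ⟨h, hhC, hhc, hhψ⟩ := exists_contDiff_cutoff (n := 4) hε hεball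
  have hgradcont : ContinuousAt (fun x => inner ℝ (∇ ρ x) n) p := by
    have h1 : ContinuousAt (fderiv ℝ ρ) p :=
      ((hρsmooth p hpU).fderiv_right (m := 3) (by norm_num)).continuousAt
    have h2 : ContinuousAt (∇ ρ) p :=
      (InnerProductSpace.toDual ℝ E3).symm.continuous.continuousAt.comp h1
    exact h2.inner continuousAt_const
  have hpos : 0 < inner ℝ (∇ ρ p) n := by
    rw [hn, real_inner_smul_right, real_inner_self_eq_norm_sq]
    positivity
  -- A positive normal component of `∇ ρ` fixes the sign of the unit normal of the graph.
  have hev1 : ∀ᶠ x in 𝓝 p, x ∈ U ∧ 0 < inner ℝ (∇ ρ x) n :=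
    Filter.Eventually.and (hdef.isOpen.mem_nhds hpU) (hgradcont.eventually (lt_mem_nhds hpos))
  obtain ⟨r₁, hr₁, hb₁⟩ := Metric.eventually_nhds_iff_ball.1 hev1
  obtain ⟨r₂, hr₂, hb₂⟩ := Metric.eventually_nhds_iff_ball.1 hψiff
  -- The three radii ensure the sign of the normal derivative, the validity of the implicit
  -- equation, and the agreement of `h` with the implicit function.
  set r := min r₁ (min r₂ (ε / 2)) with hr
  have hmem : ∀ x ∈ Metric.ball p r, x ∈ frontier Ω ↔ x ∈ range (Φ.graph h) := by
    intro x hx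
    have hxr : ‖x - p‖ < r := by rwa [← dist_eq_norm]
    have hxU : x ∈ U := (hb₁ x (Metric.ball_subset_ball (min_le_left _ _) hx)).1
    obtain ⟨v, t, hvt⟩ := Φ.exists_eq_add_smul (x - p)
    have hv : ‖v‖ < r := (hvt ▸ Φ.norm_le_norm_add_smul v t).trans_lt hxr
    have ht : |t| < r := (hvt ▸ Φ.abs_le_norm_add_smul v t).trans_lt hxr
    have hιx : ι (v, t) = x := by
      simp only [hι]
      rw [← hΦn, ← hvt, add_sub_cancel]
    have hq : (v, t) ∈ Metric.ball ((0 : E2), (0 : ℝ)) r₂ := by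
      rw [Metric.mem_ball, Prod.dist_eq, max_lt_iff, dist_zero_right, dist_zero_right]
      exact ⟨hv.trans_le ((min_le_right _ _).trans (min_le_left _ _)),
        ht.trans_le ((min_le_right _ _).trans (min_le_left _ _))⟩
    have h1 := hb₂ _ hq
    simp only [Function.comp, hι0, hρp, hιx] at h1
    have h2 : h v = ψ v := hhψ v (mem_ball_zero_iff.2
      (hv.trans_le ((min_le_right _ _).trans (min_le_right _ _))))
    rw [mem_frontier_iff_of_isLocalDefiningFunction hΩ.isOpen hdef hxU, h1, ← h2]
    constructor
    · intro he
      refine ⟨v, ?_⟩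
      rw [Frame.graph, hΦp, he, add_assoc, ← hvt, add_sub_cancel]
    · rintro ⟨u, hu⟩
      have h3 : Φ.plane u + h u • Φ.normal = Φ.plane v + t • Φ.normal := by
        rw [← hvt, ← hu, Frame.graph, hΦp, add_assoc, add_sub_cancel_left]
      obtain ⟨h4, h5⟩ := Φ.add_smul_injective h3
      rw [← h4, h5]
  have hgc : Continuous (Φ.graph h) := (Φ.contDiff_graph hhC).continuous
  refine ⟨Φ, h, r, lt_min hr₁ (lt_min hr₂ (by linarith)), hΦp, hhC, hhc, hmem, fun u hu => ?_⟩
  have hux := hb₁ _ (Metric.ball_subset_ball (min_le_left _ _) hu)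
  have huS : Φ.graph h u ∈ frontier Ω := (hmem _ hu).2 ⟨u, rfl⟩
  have h0 : (fun v => ρ (Φ.graph h v)) =ᶠ[𝓝 u] fun _ => 0 := by
    have h1 := hgc.continuousAt.eventually (Metric.isOpen_ball.mem_nhds hu)
    filter_upwards [h1] with v hv
    exact hdef.eq_zero hΩ.isOpen ((hmem _ hv).2 ⟨v, rfl⟩)
      (hb₁ _ (Metric.ball_subset_ball (min_le_left _ _) hv)).1
  have hgrad := gradient_eq_smul_of_graph ((hρsmooth _ hux.1).differentiableAt (by norm_num))
    (hhC.differentiable (by norm_num) u) h0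
  rw [outwardNormal_eq hΩ.isOpen hdef huS hux.1]
  have hb := hux.2
  rw [← hΦn] at hb
  set b := inner ℝ (∇ ρ (Φ.graph h u)) Φ.normal with hbdef
  rw [hgrad, norm_smul, norm_normal_sub_plane_gradient, Real.norm_of_nonneg hb.le, smul_smul,
    mul_inv, mul_right_comm, inv_mul_cancel₀ hb.ne', one_mul]

/-- A function of class `C²` on the boundary is of class `C²` in a graph chart. -/
theorem IsGraphChart.exists_pullback {Ω : Set E3} {p : E3} {Φ : Frame} {h : E2 → ℝ} {r : ℝ}
    (hc : IsGraphChart Ω p Φ h r) (hp : p ∈ frontier Ω) {f : E3 → ℝ}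
    (hf : ContDiffOn ℝ 2 f (frontier Ω)) :
    ∃ s, 0 < s ∧ s ≤ r ∧ ∃ g : E2 → ℝ, ContDiff ℝ 2 g ∧ HasCompactSupport g ∧
      ∀ u, Φ.graph h u ∈ Metric.ball p s → g u = f (Φ.graph h u) := by
  have hgc : ContDiff ℝ 4 (Φ.graph h) := Φ.contDiff_graph hc.contDiff
  have hopen : IsOpen (Φ.graph h ⁻¹' Metric.ball p r) := Metric.isOpen_ball.preimage hgc.continuous
  -- Projection to the plane does not increase distances, so a graph point near `p` has a parameter
  -- near `0`, where the cutoff is inactive.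
  have hnorm : ∀ u, ‖u‖ ≤ ‖Φ.graph h u - p‖ := by
    intro u
    rw [Frame.graph, hc.origin_eq, add_assoc, add_sub_cancel_left]
    exact Φ.norm_le_norm_add_smul u (h u)
  have h0 : Φ.graph h 0 = p := by
    obtain ⟨u, hu⟩ := (hc.mem_frontier_iff p (Metric.mem_ball_self hc.pos)).1 hp
    have := hnorm u
    rw [hu, sub_self, norm_zero] at this
    rw [← norm_le_zero_iff.1 this, hu]
  have hcomp : ContDiffOn ℝ 2 (f ∘ Φ.graph h) (Φ.graph h ⁻¹' Metric.ball p r) :=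
    hf.comp (hgc.of_le (by norm_num)).contDiffOn
      fun u hu => (hc.mem_frontier_iff _ hu).2 ⟨u, rfl⟩
  obtain ⟨ε, hε, hball⟩ := Metric.isOpen_iff.1 hopen 0
    (by rw [mem_preimage, h0]; exact Metric.mem_ball_self hc.pos)
  obtain ⟨g, hg, hgcs, hge⟩ := exists_contDiff_cutoff (n := 2) hε (g := f ∘ Φ.graph h)
    fun u hu => hcomp.contDiffAt (hopen.mem_nhds (hball hu))
  refine ⟨min r (ε / 2), lt_min hc.pos (by linarith), min_le_left _ _, g, hg, hgcs, fun u hu => ?_⟩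
  refine hge u ?_
  rw [mem_ball_zero_iff]
  rw [Metric.mem_ball, dist_eq_norm] at hu
  exact (hnorm u).trans_lt (hu.trans_le (min_le_right _ _))

end Chart

/-! ### Measure and weak singularities on the boundary. -/

section Surface

theorem exists_lipschitzWith {h : E2 → ℝ} (hh : ContDiff ℝ 4 h) (hc : HasCompactSupport h) :
    ∃ K : ℝ≥0, LipschitzWith K h :=
  hh.lipschitzWith_of_hasCompactSupport hc (by norm_num)

theorem Frame.norm_le_norm_graph_sub_origin (Φ : Frame) (h : E2 → ℝ) (u : E2) :
    ‖u‖ ≤ ‖Φ.graph h u - Φ.origin‖ := by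
  rw [Frame.graph, add_assoc, add_sub_cancel_left]
  exact Φ.norm_le_norm_add_smul u (h u)

/-- One disc radius serves all poles `y` near `p`. The Lipschitz bound keeps the disc inside the
chart. Outside the disc, points of the chart are at distance at least `R` because projection is
nonexpanding, and the others because `y` is well inside the chart. -/
theorem IsGraphChart.exists_disc {Ω : Set E3} {p : E3} {Φ : Frame} {h : E2 → ℝ} {r : ℝ}
    (hc : IsGraphChart Ω p Φ h r) : ∃ R, 0 < R ∧ R ≤ 1 ∧
      ∀ y ∈ frontier Ω ∩ Metric.ball p (r / 3), ∃ u₀, Φ.graph h u₀ = y ∧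
        (∀ u ∈ Metric.ball u₀ R, Φ.graph h u ∈ frontier Ω ∩ Metric.ball p r) ∧
        ∀ x ∈ frontier Ω \ Φ.graph h '' Metric.ball u₀ R, R ≤ ‖x - y‖ := by
  obtain ⟨K, hK⟩ := exists_lipschitzWith hc.contDiff hc.hasCompactSupport
  have hr := hc.pos
  have hK1 : (0 : ℝ) < 1 + K := by positivity
  -- The image of the disc has radius at most `2r/3` about a point within `r/3` of `p`. The bound 1
  -- keeps displacements in the unit ball, where the parity estimates hold.
  refine ⟨min 1 (2 * r / 3 / (1 + K)), lt_min one_pos (by positivity), min_le_left _ _, ?_⟩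
  set R := min 1 (2 * r / 3 / (1 + K)) with hR
  have hRK : (1 + K) * R ≤ 2 * r / 3 := by
    have : R ≤ 2 * r / 3 / (1 + K) := min_le_right _ _
    rw [le_div_iff₀ hK1] at this
    linarith
  have hR0 : 0 < R := lt_min one_pos (by positivity)
  rintro y ⟨hyS, hyb⟩
  have hyr : y ∈ Metric.ball p r := Metric.ball_subset_ball (by linarith) hyb
  obtain ⟨u₀, rfl⟩ := (hc.mem_frontier_iff y hyr).1 hyS
  refine ⟨u₀, rfl, fun u hu => ?_, ?_⟩
  · have h1 : Φ.graph h u ∈ Metric.ball p r := by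
      rw [Metric.mem_ball] at hu hyb ⊢
      have h2 := Φ.norm_graph_sub_le hK u u₀
      rw [← dist_eq_norm, ← dist_eq_norm] at h2
      have h3 := dist_triangle (Φ.graph h u) (Φ.graph h u₀) p
      have h4 : (1 + K) * dist u u₀ < (1 + K) * R := by gcongr
      linarith
    exact ⟨(hc.mem_frontier_iff _ h1).2 ⟨u, rfl⟩, h1⟩
  · rintro x ⟨hxS, hxD⟩
    by_cases hx : x ∈ Metric.ball p r
    · obtain ⟨u, rfl⟩ := (hc.mem_frontier_iff x hx).1 hxS
      have h1 : u ∉ Metric.ball u₀ R := fun hu => hxD ⟨u, hu, rfl⟩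
      rw [Metric.mem_ball, not_lt, dist_eq_norm] at h1
      exact h1.trans (Φ.norm_sub_le_norm_graph_sub h u u₀)
    · rw [Metric.mem_ball, not_lt] at hx
      rw [Metric.mem_ball] at hyb
      have h1 := dist_triangle x (Φ.graph h u₀) p
      rw [← dist_eq_norm]
      have h2 : R ≤ (1 + K) * R := by nlinarith [K.coe_nonneg]
      linarith

theorem isCompact_frontier {Ω : Set E3} (hΩ : IsBoundedSmoothDomain Ω) : IsCompact (frontier Ω) :=
  Metric.isCompact_of_isClosed_isBounded isClosed_frontier
    (hΩ.isBounded.closure.subset frontier_subset_closure)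

theorem measure_graph_image_lt_top (Φ : Frame) {h : E2 → ℝ} (hh : ContDiff ℝ 4 h)
    (hc : HasCompactSupport h) (R : ℝ) : μHE[2] (Φ.graph h '' Metric.ball 0 R) < ⊤ := by
  obtain ⟨K, hK⟩ := exists_lipschitzWith hh hc
  have hh1 : ContDiff ℝ 1 h := hh.of_le (by norm_num)
  have h1 : IntegrableOn (fun u => areaElement h u * (1 : ℝ)) (Metric.ball 0 R) := by
    refine IntegrableOn.mono_set ?_ Metric.ball_subset_closedBall
    exact ((continuous_areaElement hh1).mul continuous_const).continuousOn.integrableOn_compact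
      (isCompact_closedBall 0 R)
  have h2 := (Φ.integrableOn_graph_image_iff hh1 hK (Metric.ball 0 R) fun _ => 1).2 h1
  simpa using (integrableOn_const_iff (C := (1 : ℝ)) (by simp)).1 h2

theorem measure_frontier_lt_top {Ω : Set E3} (hΩ : IsBoundedSmoothDomain Ω) :
    μHE[2] (frontier Ω) < ⊤ := by
  refine (isCompact_frontier hΩ).measure_lt_top_of_nhdsWithin fun p hp => ?_
  obtain ⟨Φ, h, r, hc⟩ := exists_isGraphChart hΩ hp
  refine ⟨frontier Ω ∩ Metric.ball p r,
    inter_mem_nhdsWithin _ (Metric.ball_mem_nhds p hc.pos), ?_⟩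
  refine (measure_mono ?_).trans_lt
    (measure_graph_image_lt_top Φ hc.contDiff hc.hasCompactSupport r)
  rintro x ⟨hxS, hxb⟩
  obtain ⟨u, rfl⟩ := (hc.mem_frontier_iff x hxb).1 hxS
  refine ⟨u, ?_, rfl⟩
  rw [mem_ball_zero_iff]
  rw [Metric.mem_ball, dist_eq_norm, ← hc.origin_eq] at hxb
  exact (Φ.norm_le_norm_graph_sub_origin h u).trans_lt hxb

theorem measure_singleton_eq_zero (y : E3) : μHE[2] {y} = 0 := by
  have : NullSingletonClass (μH[((2 : ℕ) : ℝ)] : Measure E3) := nullSingletonClass_hausdorff E3 (by norm_num)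
  rw [euclideanHausdorffMeasure_def, Measure.smul_apply, measure_singleton, smul_zero]

theorem continuousOn_outwardNormal {Ω : Set E3} (hΩ : IsBoundedSmoothDomain Ω) :
    ContinuousOn (outwardNormal Ω) (frontier Ω) := by
  intro p hp
  obtain ⟨U, ρ, hdef, hpU⟩ := hΩ.smooth_boundary p hp
  have h1 : ContinuousAt (fderiv ℝ ρ) p :=
    (((hdef.contDiffOn.contDiffAt (hdef.isOpen.mem_nhds hpU)).of_le
      (m := 2) (by norm_cast)).fderiv_right (m := 1) (by norm_num)).continuousAt
  have h2 : ContinuousAt (∇ ρ) p :=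
    (InnerProductSpace.toDual ℝ E3).symm.continuous.continuousAt.comp h1
  have h3 : ContinuousAt (fun x => ‖∇ ρ x‖⁻¹ • ∇ ρ x) p :=
    (h2.norm.inv₀ (norm_ne_zero_iff.2 (hdef.gradient_ne_zero p hpU))).smul h2
  refine h3.continuousWithinAt.congr_of_eventuallyEq ?_ (outwardNormal_eq hΩ.isOpen hdef hp hpU)
  filter_upwards [self_mem_nhdsWithin, mem_nhdsWithin_of_mem_nhds (hdef.isOpen.mem_nhds hpU)]
    with x hx hxU
  exact outwardNormal_eq hΩ.isOpen hdef hx hxU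

theorem norm_outwardNormal_le_one (Ω : Set E3) (p : E3) : ‖outwardNormal Ω p‖ ≤ 1 := by
  unfold outwardNormal
  split_ifs with h
  · obtain ⟨-, U, ρ, -, -, he⟩ := h.choose_spec
    rw [he, norm_smul, norm_inv, norm_norm]
    exact inv_mul_le_one
  · simp

theorem Frame.inner_graph_sub (Φ : Frame) (h : E2 → ℝ) (u v z : E2) :
    inner ℝ (Φ.graph h u - Φ.graph h v) (Φ.normal - Φ.plane (∇ h z)) =
      h u - h v - fderiv ℝ h z (u - v) := by
  have h1 : Φ.normal - Φ.plane (∇ h z) = Φ.plane (-∇ h z) + (1 : ℝ) • Φ.normal := by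
    rw [map_neg, one_smul]; abel
  rw [Φ.graph_sub, h1, Φ.inner_add_smul, inner_neg_right, real_inner_comm, inner_gradient_left]
  ring

theorem IsGraphChart.inner_outwardNormal_source {Ω : Set E3} {p : E3} {Φ : Frame} {h : E2 → ℝ}
    {r : ℝ} (hc : IsGraphChart Ω p Φ h r) {u w : E2}
    (hw : Φ.graph h (u + w) ∈ Metric.ball p r) :
    inner ℝ (Φ.graph h (u + w) - Φ.graph h u) (outwardNormal Ω (Φ.graph h (u + w))) =
      (areaElement h (u + w))⁻¹ * sourceDefect h u w := by
  rw [hc.outwardNormal_graph _ hw, real_inner_smul_right, Φ.inner_graph_sub, add_sub_cancel_left,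
    sourceDefect]

theorem IsGraphChart.inner_outwardNormal_target {Ω : Set E3} {p : E3} {Φ : Frame} {h : E2 → ℝ}
    {r : ℝ} (hc : IsGraphChart Ω p Φ h r) {u w : E2}
    (hu : Φ.graph h u ∈ Metric.ball p r) :
    inner ℝ (Φ.graph h (u + w) - Φ.graph h u) (outwardNormal Ω (Φ.graph h u)) =
      (areaElement h u)⁻¹ * targetDefect h u w := by
  rw [hc.outwardNormal_graph _ hu, real_inner_smul_right, Φ.inner_graph_sub, add_sub_cancel_left,
    targetDefect]

theorem Frame.norm_graph_sub_eq_graphDist (Φ : Frame) (h : E2 → ℝ) (u w : E2) :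
    ‖Φ.graph h (u + w) - Φ.graph h u‖ = graphDist h u w := by
  rw [graphDist, ← Real.sqrt_sq (norm_nonneg _), Φ.norm_graph_sub_sq, add_sub_cancel_left]

/-- The normals are orthogonal to chords up to second order. -/
theorem exists_inner_outwardNormal_bound {Ω : Set E3} (hΩ : IsBoundedSmoothDomain Ω) {y : E3}
    (hy : y ∈ frontier Ω) : ∃ C : ℝ, 0 < C ∧ ∀ x ∈ frontier Ω,
      |inner ℝ (x - y) (outwardNormal Ω x)| ≤ C * ‖x - y‖ ^ 2 ∧
      |inner ℝ (x - y) (outwardNormal Ω y)| ≤ C * ‖x - y‖ ^ 2 := by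
  obtain ⟨Φ, h, r, hc⟩ := exists_isGraphChart hΩ hy
  have hr := hc.pos
  obtain ⟨R, hR, hR1, hdisc⟩ := hc.exists_disc
  obtain ⟨u, rfl, hball, hfar⟩ := hdisc y ⟨hy, Metric.mem_ball_self (by positivity)⟩
  obtain ⟨B, hB, hb⟩ := exists_defect_bounds hc.contDiff hc.hasCompactSupport
  have hub := (hball u (Metric.mem_ball_self hR)).2
  -- `B` is the Taylor constant near `y`; away from it `‖x - y‖ ≤ R⁻¹ ‖x - y‖²`.
  refine ⟨max B R⁻¹, lt_max_of_lt_left hB, fun x hx => ?_⟩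
  by_cases hxD : x ∈ Φ.graph h '' Metric.ball u R
  · obtain ⟨v, hv, rfl⟩ := hxD
    obtain ⟨w, rfl⟩ : ∃ w, v = u + w := ⟨v - u, by abel⟩
    have hw : ‖w‖ ≤ 1 := by
      rw [mem_ball_iff_norm, add_sub_cancel_left] at hv
      linarith
    obtain ⟨b1, b2, -⟩ := hb u w hw
    rw [hc.inner_outwardNormal_source (hball _ hv).2, hc.inner_outwardNormal_target hub,
      Φ.norm_graph_sub_eq_graphDist]
    have key : ∀ (J d : ℝ), 1 ≤ J → |d| ≤ B * ‖w‖ ^ 2 →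
        |J⁻¹ * d| ≤ max B R⁻¹ * graphDist h u w ^ 2 := by
      intro J d hJ hd
      rw [abs_mul, abs_of_pos (by positivity)]
      have h1 := norm_le_graphDist h u w
      calc J⁻¹ * |d| ≤ 1 * (B * ‖w‖ ^ 2) := by
            gcongr
            exact inv_le_one_of_one_le₀ hJ
        _ ≤ max B R⁻¹ * graphDist h u w ^ 2 := by
            rw [one_mul]
            gcongr
            exact le_max_left _ _
    exact ⟨key _ _ (one_le_areaElement _ _) b1, key _ _ (one_le_areaElement _ _) b2⟩
  · have h1 := hfar x ⟨hx, hxD⟩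
    have key : ∀ z, |inner ℝ (x - Φ.graph h u) (outwardNormal Ω z)| ≤
        max B R⁻¹ * ‖x - Φ.graph h u‖ ^ 2 := by
      intro z
      refine (abs_real_inner_le_norm _ _).trans ?_
      have h2 := norm_outwardNormal_le_one Ω z
      have h3 := norm_nonneg (x - Φ.graph h u)
      calc ‖x - Φ.graph h u‖ * ‖outwardNormal Ω z‖ ≤ ‖x - Φ.graph h u‖ * 1 := by gcongr
        _ = R⁻¹ * (R * ‖x - Φ.graph h u‖) := by field_simp
        _ ≤ R⁻¹ * (‖x - Φ.graph h u‖ * ‖x - Φ.graph h u‖) := by gcongr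
        _ ≤ max B R⁻¹ * ‖x - Φ.graph h u‖ ^ 2 := by
          rw [← sq]
          gcongr
          exact le_max_right _ _
    exact ⟨key _, key _⟩

theorem integrableOn_inv_norm_sub_ball (u : E2) (R : ℝ) :
    IntegrableOn (fun v : E2 => ‖v - u‖⁻¹) (Metric.ball u R) := by
  have h1 : IntegrableOn (fun v : E2 => ‖v‖⁻¹) (Metric.ball 0 R) := by
    refine integrableOn_ball_of_norm_le_rpow (C := 1) (α := 1) (by simp) (by simp)
      (ae_of_all _ fun v => ?_) (by fun_prop)
    rw [Real.rpow_neg (norm_nonneg _), Real.rpow_one, norm_inv, norm_norm, one_mul]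
  have h2 := ((measurePreserving_sub_right (volume : Measure E2) u).integrableOn_comp_preimage
    (MeasurableEquiv.subRight u).measurableEmbedding (f := fun v : E2 => ‖v‖⁻¹)
    (s := Metric.ball 0 R)).2 h1
  have h3 : (fun v : E2 => v - u) ⁻¹' Metric.ball 0 R = Metric.ball u R := by
    ext v; rw [mem_preimage, mem_ball_zero_iff, mem_ball_iff_norm]
  rw [h3] at h2
  exact h2

/-- In a chart, distances on the graph dominate parameter distances and `‖w‖⁻¹` is integrable in the
plane. The rest is bounded on a set of finite area. -/
theorem integrableOn_inv_norm_sub {Ω : Set E3} (hΩ : IsBoundedSmoothDomain Ω) {y : E3}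
    (hy : y ∈ frontier Ω) : IntegrableOn (fun x => ‖x - y‖⁻¹) (frontier Ω) μHE[2] := by
  obtain ⟨Φ, h, r, hc⟩ := exists_isGraphChart hΩ hy
  have hr := hc.pos
  obtain ⟨R, hR, hR1, hdisc⟩ := hc.exists_disc
  obtain ⟨u, rfl, hball, hfar⟩ := hdisc y ⟨hy, Metric.mem_ball_self (by positivity)⟩
  obtain ⟨K, hK⟩ := exists_lipschitzWith hc.contDiff hc.hasCompactSupport
  have hh1 : ContDiff ℝ 1 h := hc.contDiff.of_le (by norm_num)
  have hD : MeasurableSet (Φ.graph h '' Metric.ball u R) :=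
    (Φ.measurableEmbedding_graph hh1.continuous).measurableSet_image.2 measurableSet_ball
  have hnear : IntegrableOn (fun x => ‖x - Φ.graph h u‖⁻¹) (Φ.graph h '' Metric.ball u R)
      μHE[2] := by
    rw [Φ.integrableOn_graph_image_iff hh1 hK]
    obtain ⟨M, hM⟩ := (isCompact_closedBall u R).exists_bound_of_continuousOn
      (continuous_areaElement hh1).continuousOn
    have hgc := (Φ.contDiff_graph hh1).continuous
    refine ((integrableOn_inv_norm_sub_ball u R).const_mul M).mono' ?_ ?_
    · have h1 : Measurable fun v => ‖Φ.graph h v - Φ.graph h u‖⁻¹ :=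
        (hgc.sub continuous_const).norm.measurable.inv
      exact ((continuous_areaElement hh1).measurable.mul h1).aestronglyMeasurable
    · refine ae_restrict_of_forall_mem measurableSet_ball fun v hv => ?_
      have h1 := hM v (Metric.ball_subset_closedBall hv)
      rw [norm_mul, norm_inv, norm_norm]
      have hM0 : 0 ≤ M := (norm_nonneg _).trans h1
      rcases eq_or_ne v u with rfl | hne
      · simp
      · have h2 : 0 < ‖v - u‖ := norm_pos_iff.2 (sub_ne_zero.2 hne)
        have h3 := Φ.norm_sub_le_norm_graph_sub h v u
        gcongr
  have hrest : IntegrableOn (fun x => ‖x - Φ.graph h u‖⁻¹)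
      (frontier Ω \ Φ.graph h '' Metric.ball u R) μHE[2] := by
    refine Measure.integrableOn_of_bounded (M := R⁻¹)
      ((measure_mono sdiff_subset).trans_lt (measure_frontier_lt_top hΩ)).ne
      (by fun_prop) ?_
    refine ae_restrict_of_forall_mem (isClosed_frontier.measurableSet.diff hD) fun x hx => ?_
    have h1 := hfar x hx
    rw [norm_inv, norm_norm]
    gcongr
  exact (hnear.union hrest).mono_set (by rw [union_sdiff_self]; exact subset_union_right)

/-- A weakly singular function is integrable over the boundary. -/
theorem surfaceIntegrable_of_le {Ω : Set E3} (hΩ : IsBoundedSmoothDomain Ω) {y : E3}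
    (hy : y ∈ frontier Ω) {F : E3 → ℝ} {C : ℝ} (hF : ContinuousOn F (frontier Ω \ {y}))
    (hb : ∀ x ∈ frontier Ω, x ≠ y → |F x| ≤ C * ‖x - y‖⁻¹) : SurfaceIntegrable Ω F := by
  have hm : MeasurableSet (frontier Ω \ {y}) :=
    isClosed_frontier.measurableSet.diff (measurableSet_singleton y)
  have h1 : IntegrableOn F (frontier Ω \ {y}) μHE[2] := by
    refine (((integrableOn_inv_norm_sub hΩ hy).mono_set sdiff_subset).const_mul C).mono'
      (hF.aestronglyMeasurable hm) ?_
    exact ae_restrict_of_forall_mem hm fun x hx => hb x hx.1 hx.2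
  have h2 : IntegrableOn F {y} μHE[2] := by
    have : (μHE[2] : Measure E3).restrict {y} = 0 :=
      Measure.restrict_eq_zero.2 (measure_singleton_eq_zero y)
    rw [IntegrableOn, this]
    exact integrable_zero_measure
  exact (h1.union h2).mono_set (by simp)

end Surface

/-! ### The four integrands: algebra and absolute convergence. -/

section Integrands

theorem shapeFactor_zero : shapeFactor 0 = 0 := by simp [shapeFactor, erf]

theorem shapeFactor_nonneg {t : ℝ} (ht : 0 ≤ t) : 0 ≤ shapeFactor t := by
  rw [← shapeFactor_zero]
  exact monotone_shapeFactor ht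

theorem abs_errorKernel_le {δ r : ℝ} (hδ : 0 < δ) (hr : 0 < r) : |errorKernel δ r| ≤ (r ^ 3)⁻¹ := by
  have h1 := shapeFactor_nonneg (t := r / δ) (by positivity)
  have h2 := shapeFactor_le_one (r / δ)
  have hpi : (1 : ℝ) ≤ Real.pi := by linarith [Real.two_le_pi]
  rw [errorKernel, abs_div, abs_of_nonpos (by linarith), abs_of_pos (by positivity), ← one_div]
  gcongr
  · linarith
  · nlinarith [pow_pos hr 3]

/-- The decay `(1 + R/δ)⁻⁴` is at most `(R/δ)⁻³`, for every `δ` and not only small ones. -/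
theorem exists_errorKernel_far_bound {R : ℝ} (hR : 0 < R) : ∃ C : ℝ, 0 < C ∧
    ∀ δ : ℝ, 0 < δ → ∀ r, R ≤ r → |errorKernel δ r| ≤ C * δ ^ 3 := by
  obtain ⟨B, hB, hb⟩ := exists_errorKernel_bounds
  refine ⟨B / R ^ 6, by positivity, fun δ hδ r hr => ((hb δ R hδ hR).1 r hr).trans ?_⟩
  have h1 : (R / δ) ^ 3 ≤ (1 + R / δ) ^ 4 := by
    have h0 : 0 ≤ R / δ := by positivity
    calc (R / δ) ^ 3 ≤ (1 + R / δ) ^ 3 := by gcongr; linarith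
      _ ≤ (1 + R / δ) ^ 4 := pow_le_pow_right₀ (by linarith) (by norm_num)
  calc B / (R ^ 3 * (1 + R / δ) ^ 4) ≤ B / (R ^ 3 * (R / δ) ^ 3) := by gcongr
    _ = B / R ^ 6 * δ ^ 3 := by field_simp

theorem normalSumErrorIntegrand_eq (Ω : Set E3) {δ : ℝ} (hδ : 0 < δ) (f : E3 → ℝ) {x y : E3}
    (h : x ≠ y) : normalSumErrorIntegrand Ω δ f y x =
      f x * (errorKernel δ ‖x - y‖ *
        (inner ℝ (x - y) (outwardNormal Ω y) + inner ℝ (x - y) (outwardNormal Ω x))) := by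
  rw [normalSumErrorIntegrand, gradient_greenReg_sub_gradient_green (sub_ne_zero.2 h) hδ,
    real_inner_smul_left, inner_add_right]

theorem doubleLayerErrorIntegrand_eq (Ω : Set E3) {δ : ℝ} (hδ : 0 < δ) (f : E3 → ℝ) {x y : E3}
    (h : x ≠ y) : doubleLayerErrorIntegrand Ω δ f y x =
      (f x - f y) * (errorKernel δ ‖x - y‖ * inner ℝ (x - y) (outwardNormal Ω x)) := by
  rw [doubleLayerErrorIntegrand, gradient_greenReg_sub_gradient_green (sub_ne_zero.2 h) hδ,
    real_inner_smul_left]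

theorem regularizedIntegrand_eq (Ω : Set E3) (δ : ℝ) (f : E3 → ℝ) (y x : E3) :
    regularizedIntegrand Ω δ f y x =
      modifiedIntegrand Ω f y x * shapeFactor (‖x - y‖ / δ) := by
  rw [regularizedIntegrand, modifiedIntegrand]
  ring

theorem inner_modified_eq (Ω : Set E3) (f : E3 → ℝ) (y x : E3) :
    inner ℝ (f x • outwardNormal Ω y + f y • outwardNormal Ω x) (y - x) =
      -(f x * inner ℝ (x - y) (outwardNormal Ω y) + f y * inner ℝ (x - y) (outwardNormal Ω x)) := by
  rw [← neg_sub x y, inner_neg_right, inner_add_left, real_inner_smul_left, real_inner_smul_left,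
    real_inner_comm, real_inner_comm (x - y)]

/-- Write `f y = f x - (f x - f y)` in front of `n(x)`; the sign comes from `y - x` replacing `x -
y`. -/
theorem regularizedIntegrand_sub_modifiedIntegrand (Ω : Set E3) {δ : ℝ} (hδ : 0 < δ) (f : E3 → ℝ)
    {x y : E3} (h : x ≠ y) :
    regularizedIntegrand Ω δ f y x - modifiedIntegrand Ω f y x =
      doubleLayerErrorIntegrand Ω δ f y x - normalSumErrorIntegrand Ω δ f y x := by
  rw [regularizedIntegrand_eq, modifiedIntegrand, normalSumErrorIntegrand_eq Ω hδ f h,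
    doubleLayerErrorIntegrand_eq Ω hδ f h, inner_modified_eq, errorKernel]
  ring

theorem continuousOn_norm_sub_pow_ne {S : Set E3} {y : E3} :
    ∀ x ∈ S \ {y}, 4 * Real.pi * ‖x - y‖ ^ 3 ≠ 0 := fun x hx => by
  have : 0 < ‖x - y‖ := norm_pos_iff.2 (sub_ne_zero.2 hx.2)
  positivity

variable {Ω : Set E3} {f : E3 → ℝ}

theorem continuousOn_modifiedIntegrand (hΩ : IsBoundedSmoothDomain Ω)
    (hf : ContinuousOn f (frontier Ω)) (y : E3) :
    ContinuousOn (modifiedIntegrand Ω f y) (frontier Ω \ {y}) := by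
  unfold modifiedIntegrand
  have h1 := hf.mono (sdiff_subset (t := {y}))
  have h2 := (continuousOn_outwardNormal hΩ).mono (sdiff_subset (t := {y}))
  have h3 : ContinuousOn (fun x : E3 => y - x) (frontier Ω \ {y}) := by fun_prop
  have h4 : ContinuousOn (fun x => f x • outwardNormal Ω y + f y • outwardNormal Ω x)
      (frontier Ω \ {y}) := (h1.smul continuousOn_const).add (h2.const_smul (f y))
  have h5 : ContinuousOn (fun x : E3 => 4 * Real.pi * ‖x - y‖ ^ 3) (frontier Ω \ {y}) := by fun_prop
  exact (h4.inner (𝕜 := ℝ) h3).div h5 continuousOn_norm_sub_pow_ne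

theorem continuousOn_errorKernel (S : Set E3) (δ : ℝ) (y : E3) :
    ContinuousOn (fun x => errorKernel δ ‖x - y‖) (S \ {y}) := by
  unfold errorKernel
  refine ContinuousOn.div ?_ (by fun_prop) continuousOn_norm_sub_pow_ne
  exact ((continuous_shapeFactor.comp (by fun_prop : Continuous fun x : E3 => ‖x - y‖ / δ)).sub
    continuous_const).continuousOn

theorem continuousOn_normalSumErrorIntegrand (hΩ : IsBoundedSmoothDomain Ω)
    (hf : ContinuousOn f (frontier Ω)) {δ : ℝ} (hδ : 0 < δ) (y : E3) :
    ContinuousOn (normalSumErrorIntegrand Ω δ f y) (frontier Ω \ {y}) := by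
  have h1 := hf.mono (sdiff_subset (t := {y}))
  have h2 := (continuousOn_outwardNormal hΩ).mono (sdiff_subset (t := {y}))
  have h3 : ContinuousOn (fun x : E3 => x - y) (frontier Ω \ {y}) := by fun_prop
  refine (h1.mul ((continuousOn_errorKernel _ δ y).mul ((h3.inner (𝕜 := ℝ)
    continuousOn_const).add (h3.inner (𝕜 := ℝ) h2)))).congr
    fun x hx => normalSumErrorIntegrand_eq Ω hδ f hx.2

theorem continuousOn_doubleLayerErrorIntegrand (hΩ : IsBoundedSmoothDomain Ω)
    (hf : ContinuousOn f (frontier Ω)) {δ : ℝ} (hδ : 0 < δ) (y : E3) :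
    ContinuousOn (doubleLayerErrorIntegrand Ω δ f y) (frontier Ω \ {y}) := by
  have h1 := hf.mono (sdiff_subset (t := {y}))
  have h2 := (continuousOn_outwardNormal hΩ).mono (sdiff_subset (t := {y}))
  have h3 : ContinuousOn (fun x : E3 => x - y) (frontier Ω \ {y}) := by fun_prop
  refine ((h1.sub continuousOn_const).mul ((continuousOn_errorKernel _ δ y).mul (h3.inner (𝕜 := ℝ)
    h2))).congr fun x hx => doubleLayerErrorIntegrand_eq Ω hδ f hx.2

theorem exists_bound_on_frontier (hΩ : IsBoundedSmoothDomain Ω)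
    (hf : ContinuousOn f (frontier Ω)) : ∃ M : ℝ, 0 < M ∧ ∀ x ∈ frontier Ω, |f x| ≤ M := by
  obtain ⟨M, hM⟩ := (isCompact_frontier hΩ).exists_bound_of_continuousOn hf
  exact ⟨max M 1, lt_max_of_lt_right one_pos, fun x hx => (hM x hx).trans (le_max_left _ _)⟩

theorem surfaceIntegrable_modifiedIntegrand (hΩ : IsBoundedSmoothDomain Ω)
    (hf : ContinuousOn f (frontier Ω)) {y : E3} (hy : y ∈ frontier Ω) :
    SurfaceIntegrable Ω (modifiedIntegrand Ω f y) := by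
  obtain ⟨M, hM, hfM⟩ := exists_bound_on_frontier hΩ hf
  obtain ⟨C, hC, hb⟩ := exists_inner_outwardNormal_bound hΩ hy
  refine surfaceIntegrable_of_le hΩ hy (C := 2 * M * C) (continuousOn_modifiedIntegrand hΩ hf y)
    fun x hx hne => ?_
  have hpos : 0 < ‖x - y‖ := norm_pos_iff.2 (sub_ne_zero.2 hne)
  have hpi : (1 : ℝ) ≤ Real.pi := by linarith [Real.two_le_pi]
  obtain ⟨b1, b2⟩ := hb x hx
  have h1 := hfM x hx
  have h2 := hfM y hy
  rw [modifiedIntegrand, inner_modified_eq, abs_div, abs_neg,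
    abs_of_pos (show 0 < 4 * Real.pi * ‖x - y‖ ^ 3 by positivity)]
  calc _ ≤ (M * (C * ‖x - y‖ ^ 2) + M * (C * ‖x - y‖ ^ 2)) / ‖x - y‖ ^ 3 := by
        gcongr
        · refine (abs_add_le _ _).trans ?_
          rw [abs_mul, abs_mul]
          gcongr
        · nlinarith [pow_pos hpos 3]
    _ = 2 * M * C * ‖x - y‖⁻¹ := by field_simp; ring

theorem surfaceIntegrable_normalSumErrorIntegrand (hΩ : IsBoundedSmoothDomain Ω)
    (hf : ContinuousOn f (frontier Ω)) {δ : ℝ} (hδ : 0 < δ) {y : E3} (hy : y ∈ frontier Ω) :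
    SurfaceIntegrable Ω (normalSumErrorIntegrand Ω δ f y) := by
  obtain ⟨M, hM, hfM⟩ := exists_bound_on_frontier hΩ hf
  obtain ⟨C, hC, hb⟩ := exists_inner_outwardNormal_bound hΩ hy
  refine surfaceIntegrable_of_le hΩ hy (C := 2 * M * C)
    (continuousOn_normalSumErrorIntegrand hΩ hf hδ y) fun x hx hne => ?_
  have hpos : 0 < ‖x - y‖ := norm_pos_iff.2 (sub_ne_zero.2 hne)
  obtain ⟨b1, b2⟩ := hb x hx
  rw [normalSumErrorIntegrand_eq Ω hδ f hne, abs_mul, abs_mul]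
  calc _ ≤ M * ((‖x - y‖ ^ 3)⁻¹ * (C * ‖x - y‖ ^ 2 + C * ‖x - y‖ ^ 2)) := by
        gcongr
        · exact hfM x hx
        · exact abs_errorKernel_le hδ hpos
        · exact (abs_add_le _ _).trans (add_le_add b2 b1)
    _ = 2 * M * C * ‖x - y‖⁻¹ := by field_simp; ring

theorem surfaceIntegrable_doubleLayerErrorIntegrand (hΩ : IsBoundedSmoothDomain Ω)
    (hf : ContinuousOn f (frontier Ω)) {δ : ℝ} (hδ : 0 < δ) {y : E3} (hy : y ∈ frontier Ω) :
    SurfaceIntegrable Ω (doubleLayerErrorIntegrand Ω δ f y) := by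
  obtain ⟨M, hM, hfM⟩ := exists_bound_on_frontier hΩ hf
  obtain ⟨C, hC, hb⟩ := exists_inner_outwardNormal_bound hΩ hy
  refine surfaceIntegrable_of_le hΩ hy (C := 2 * M * C)
    (continuousOn_doubleLayerErrorIntegrand hΩ hf hδ y) fun x hx hne => ?_
  have hpos : 0 < ‖x - y‖ := norm_pos_iff.2 (sub_ne_zero.2 hne)
  obtain ⟨b1, b2⟩ := hb x hx
  rw [doubleLayerErrorIntegrand_eq Ω hδ f hne, abs_mul, abs_mul]
  calc _ ≤ (M + M) * ((‖x - y‖ ^ 3)⁻¹ * (C * ‖x - y‖ ^ 2)) := by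
        gcongr
        · exact (abs_sub _ _).trans (add_le_add (hfM x hx) (hfM y hy))
        · exact abs_errorKernel_le hδ hpos
    _ = 2 * M * C * ‖x - y‖⁻¹ := by field_simp; ring

theorem surfaceIntegrable_regularizedIntegrand (hΩ : IsBoundedSmoothDomain Ω)
    (hf : ContinuousOn f (frontier Ω)) {δ : ℝ} (hδ : 0 < δ) {y : E3} (hy : y ∈ frontier Ω) :
    SurfaceIntegrable Ω (regularizedIntegrand Ω δ f y) := by
  have h1 := surfaceIntegrable_modifiedIntegrand hΩ hf hy
  have h2 : regularizedIntegrand Ω δ f y =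
      fun x => modifiedIntegrand Ω f y x * shapeFactor (‖x - y‖ / δ) :=
    funext fun x => regularizedIntegrand_eq Ω δ f y x
  rw [h2]
  refine Integrable.mul_bdd (c := 1) h1 ?_ (ae_of_all _ fun x => ?_)
  · exact (continuous_shapeFactor.comp
      (by fun_prop : Continuous fun x : E3 => ‖x - y‖ / δ)).aestronglyMeasurable
  · rw [Real.norm_of_nonneg (shapeFactor_nonneg (by positivity))]
    exact shapeFactor_le_one _

theorem ae_restrict_ne (S : Set E3) (y : E3) : ∀ᵐ x ∂((μHE[2] : Measure E3).restrict S), x ≠ y :=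
  ae_restrict_of_ae (compl_mem_ae_iff.2 (measure_singleton_eq_zero y))

theorem regularizedADL_sub_modifiedADL (hΩ : IsBoundedSmoothDomain Ω)
    (hf : ContinuousOn f (frontier Ω)) {δ : ℝ} (hδ : 0 < δ) {y : E3} (hy : y ∈ frontier Ω) :
    regularizedADL Ω δ f y - modifiedADL Ω f y =
      surfaceIntegral Ω (doubleLayerErrorIntegrand Ω δ f y) -
        surfaceIntegral Ω (normalSumErrorIntegrand Ω δ f y) := by
  rw [regularizedADL, modifiedADL, add_sub_add_right_eq_sub]
  unfold surfaceIntegral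
  rw [← integral_sub (surfaceIntegrable_regularizedIntegrand hΩ hf hδ hy)
      (surfaceIntegrable_modifiedIntegrand hΩ hf hy),
    ← integral_sub (surfaceIntegrable_doubleLayerErrorIntegrand hΩ hf hδ hy)
      (surfaceIntegrable_normalSumErrorIntegrand hΩ hf hδ hy)]
  refine integral_congr_ae ?_
  filter_upwards [ae_restrict_ne (frontier Ω) y] with x hx
  exact regularizedIntegrand_sub_modifiedIntegrand Ω hδ f hx

end Integrands

/-! ### From the local estimate to the whole boundary. -/

section Estimate

variable {Ω : Set E3}

/-- A family of weakly singular integrals that is odd of third order in a graph chart is of third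
order in the regularization parameter, locally uniformly in the pole. -/
theorem IsGraphChart.exists_surfaceIntegral_bound (hΩ : IsBoundedSmoothDomain Ω) {p : E3}
    {Φ : Frame} {h : E2 → ℝ} {r : ℝ} (hc : IsGraphChart Ω p Φ h r) {F : ℝ → E3 → E3 → ℝ}
    {a : E2 → E2 → ℝ} {K M : ℝ} (hK : 0 ≤ K) (hM : 0 ≤ M)
    (hint : ∀ δ, 0 < δ → ∀ y ∈ frontier Ω, SurfaceIntegrable Ω (F δ y))
    (hbound : ∀ δ, 0 < δ → ∀ y ∈ frontier Ω, ∀ x ∈ frontier Ω, x ≠ y →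
      |F δ y x| ≤ M * |errorKernel δ ‖x - y‖|)
    (hpar : ∀ u, HasParity 3 K (a u))
    (hchart : ∀ δ, 0 < δ → ∀ u w, w ≠ 0 → Φ.graph h u ∈ Metric.ball p r →
      Φ.graph h (u + w) ∈ Metric.ball p r →
      areaElement h (u + w) * F δ (Φ.graph h u) (Φ.graph h (u + w)) =
        a u w * errorKernel δ (graphDist h u w)) :
    ∃ C : ℝ, ∀ δ : ℝ, 0 < δ → ∀ y ∈ frontier Ω ∩ Metric.ball p (r / 3),
      |surfaceIntegral Ω (F δ y)| ≤ C * δ ^ 3 := by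
  obtain ⟨R, hR, hR1, hdisc⟩ := hc.exists_disc
  obtain ⟨L, hL⟩ := exists_lipschitzWith hc.contDiff hc.hasCompactSupport
  have hh1 : ContDiff ℝ 1 h := hc.contDiff.of_le (by norm_num)
  obtain ⟨C₁, hC₁, hnear⟩ := exists_integral_errorKernel_bound
    (hc.contDiff.of_le (by norm_num)) hc.hasCompactSupport hK
  obtain ⟨C₂, hC₂, hfar⟩ := exists_errorKernel_far_bound hR
  refine ⟨C₁ + M * C₂ * (μHE[2] (frontier Ω)).toReal, fun δ hδ y hy => ?_⟩
  obtain ⟨u, rfl, hball, hrest⟩ := hdisc y hy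
  set D := Φ.graph h '' Metric.ball u R with hD
  have hDm : MeasurableSet D :=
    (Φ.measurableEmbedding_graph hh1.continuous).measurableSet_image.2 measurableSet_ball
  have hDS : D ⊆ frontier Ω := by
    rintro _ ⟨v, hv, rfl⟩
    exact (hball v hv).1
  have hub := (hball u (Metric.mem_ball_self hR)).2
  have hsplit : surfaceIntegral Ω (F δ (Φ.graph h u)) =
      (∫ x in frontier Ω \ D, F δ (Φ.graph h u) x ∂μHE[2]) +
        ∫ x in D, F δ (Φ.graph h u) x ∂μHE[2] := by
    rw [setIntegral_sdiff hDm (hint δ hδ _ hy.1) hDS, surfaceIntegral]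
    ring
  have hDint : ∫ x in D, F δ (Φ.graph h u) x ∂μHE[2] =
      ∫ w in Metric.ball 0 R, a u w * errorKernel δ (graphDist h u w) := by
    rw [hD, Φ.setIntegral_graph_image hh1 hL]
    have h1 := (measurePreserving_add_left (volume : Measure E2) u).setIntegral_preimage_emb
      (MeasurableEquiv.addLeft u).measurableEmbedding
      (fun v => areaElement h v * F δ (Φ.graph h u) (Φ.graph h v)) (Metric.ball u R)
    have h2 : (fun w : E2 => u + w) ⁻¹' Metric.ball u R = Metric.ball 0 R := by
      ext w; rw [mem_preimage, mem_ball_zero_iff, mem_ball_iff_norm, add_sub_cancel_left]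
    rw [h2] at h1
    rw [← h1]
    -- The formula in the chart fails to cover only `w = 0`, the pole, which is a null set.
    refine setIntegral_congr_ae measurableSet_ball ?_
    have h3 : ∀ᵐ w : E2, w ≠ 0 := compl_mem_ae_iff.2 (measure_singleton (0 : E2))
    filter_upwards [h3] with w hw hwb
    refine hchart δ hδ u w hw hub (hball _ ?_).2
    rw [← h2] at hwb
    exact hwb
  have hfarint : |∫ x in frontier Ω \ D, F δ (Φ.graph h u) x ∂μHE[2]| ≤
      M * (C₂ * δ ^ 3) * (μHE[2] (frontier Ω)).toReal := by
    have hfin : μHE[2] (frontier Ω \ D) < ⊤ :=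
      (measure_mono sdiff_subset).trans_lt (measure_frontier_lt_top hΩ)
    have h1 := norm_setIntegral_le_of_norm_le_const (C := M * (C₂ * δ ^ 3)) hfin
      (f := F δ (Φ.graph h u)) fun x hx => by
        have hx1 := hrest x hx
        have hne : x ≠ Φ.graph h u := by
          rintro rfl
          rw [sub_self, norm_zero] at hx1
          linarith
        refine (hbound δ hδ _ hy.1 x hx.1 hne).trans ?_
        gcongr
        exact hfar δ hδ _ hx1
    refine h1.trans ?_
    gcongr
    exact ENNReal.toReal_mono (measure_frontier_lt_top hΩ).ne (measure_mono sdiff_subset)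
  rw [hsplit, hDint]
  refine (abs_add_le _ _).trans ?_
  have h4 := hnear δ hδ R hR1 u (a u) (hpar u)
  calc _ ≤ M * (C₂ * δ ^ 3) * (μHE[2] (frontier Ω)).toReal + C₁ * δ ^ 3 := add_le_add hfarint h4
    _ = _ := by ring

variable {f : E3 → ℝ}

/-- The chart is shrunk until `f` is given there by a compactly supported `C²` function of the
parameter. The area element cancels the denominator of the source normal, leaving the densities of
`exists_hasParity_densities`. The crude bounds by `M` and `B` serve only away from the pole. -/
theorem exists_local_error_bound (hΩ : IsBoundedSmoothDomain Ω)
    (hf : ContDiffOn ℝ 2 f (frontier Ω)) {p : E3} (hp : p ∈ frontier Ω) :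
    ∃ r > 0, ∃ C : ℝ, ∀ δ : ℝ, 0 < δ → ∀ y ∈ frontier Ω ∩ Metric.ball p r,
      |surfaceIntegral Ω (normalSumErrorIntegrand Ω δ f y)| ≤ C * δ ^ 3 ∧
      |surfaceIntegral Ω (doubleLayerErrorIntegrand Ω δ f y)| ≤ C * δ ^ 3 := by
  obtain ⟨Φ, h, r, hc'⟩ := exists_isGraphChart hΩ hp
  obtain ⟨s, hs, hsr, g, hg, hgc, hgf⟩ := hc'.exists_pullback hp hf
  have hc := hc'.mono hs hsr
  obtain ⟨K, hK, hpar⟩ := exists_hasParity_densities hc.contDiff hc.hasCompactSupport hg hgc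
  obtain ⟨M, hM, hfM⟩ := exists_bound_on_frontier hΩ hf.continuousOn
  obtain ⟨B, hB⟩ := Metric.isBounded_iff.1 (isCompact_frontier hΩ).isBounded
  have hB0 : 0 ≤ B := dist_nonneg.trans (hB hp hp)
  have hinner : ∀ y ∈ frontier Ω, ∀ x ∈ frontier Ω, ∀ z,
      |inner ℝ (x - y) (outwardNormal Ω z)| ≤ B := by
    intro y hy x hx z
    refine (abs_real_inner_le_norm _ _).trans ?_
    rw [← dist_eq_norm]
    calc dist x y * ‖outwardNormal Ω z‖ ≤ B * 1 := by
          gcongr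
          · exact hB hx hy
          · exact norm_outwardNormal_le_one Ω z
      _ = B := mul_one B
  have hne : ∀ {u w : E2}, w ≠ 0 → Φ.graph h (u + w) ≠ Φ.graph h u := by
    intro u w hw he
    have := norm_le_graphDist h u w
    rw [← Φ.norm_graph_sub_eq_graphDist, he, sub_self, norm_zero] at this
    exact hw (norm_le_zero_iff.1 this)
  obtain ⟨C₁, h₁⟩ := hc.exists_surfaceIntegral_bound hΩ
    (F := fun δ y x => normalSumErrorIntegrand Ω δ f y x) (M := M * (B + B)) hK (by positivity)
    (fun δ hδ y hy => surfaceIntegrable_normalSumErrorIntegrand hΩ hf.continuousOn hδ hy)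
    (fun δ hδ y hy x hx hxy => by
      rw [normalSumErrorIntegrand_eq Ω hδ f hxy, abs_mul, abs_mul]
      calc _ ≤ M * (|errorKernel δ ‖x - y‖| * (B + B)) := by
            gcongr
            · exact hfM x hx
            · exact (abs_add_le _ _).trans (add_le_add (hinner y hy x hx y) (hinner y hy x hx x))
        _ = _ := by ring)
    (fun u => (hpar u).1)
    (fun δ hδ u w hw hu huw => by
      rw [normalSumErrorIntegrand_eq Ω hδ f (hne hw), hc.inner_outwardNormal_source huw,
        hc.inner_outwardNormal_target hu, Φ.norm_graph_sub_eq_graphDist, hgf _ huw]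
      have := (areaElement_pos h (u + w)).ne'
      field_simp
      ring)
  obtain ⟨C₂, h₂⟩ := hc.exists_surfaceIntegral_bound hΩ
    (F := fun δ y x => doubleLayerErrorIntegrand Ω δ f y x) (M := (M + M) * B) hK (by positivity)
    (fun δ hδ y hy => surfaceIntegrable_doubleLayerErrorIntegrand hΩ hf.continuousOn hδ hy)
    (fun δ hδ y hy x hx hxy => by
      rw [doubleLayerErrorIntegrand_eq Ω hδ f hxy, abs_mul, abs_mul]
      calc _ ≤ (M + M) * (|errorKernel δ ‖x - y‖| * B) := by
            gcongr
            · exact (abs_sub _ _).trans (add_le_add (hfM x hx) (hfM y hy))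
            · exact hinner y hy x hx x
        _ = _ := by ring)
    (fun u => (hpar u).2)
    (fun δ hδ u w hw hu huw => by
      rw [doubleLayerErrorIntegrand_eq Ω hδ f (hne hw), hc.inner_outwardNormal_source huw,
        Φ.norm_graph_sub_eq_graphDist, hgf _ huw, hgf _ hu]
      have := (areaElement_pos h (u + w)).ne'
      field_simp)
  refine ⟨s / 3, by positivity, max C₁ C₂, fun δ hδ y hy => ⟨?_, ?_⟩⟩
  · refine (h₁ δ hδ y hy).trans ?_
    gcongr
    exact le_max_left _ _
  · refine (h₂ δ hδ y hy).trans ?_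
    gcongr
    exact le_max_right _ _

/-- The local constants do not depend on `δ`, so a finite cover of the compact boundary yields a
global one. -/
theorem exists_error_bound (hΩ : IsBoundedSmoothDomain Ω) (hf : ContDiffOn ℝ 2 f (frontier Ω)) :
    ∃ C : ℝ, ∀ δ : ℝ, 0 < δ → ∀ y ∈ frontier Ω,
      |surfaceIntegral Ω (normalSumErrorIntegrand Ω δ f y)| ≤ C * δ ^ 3 ∧
      |surfaceIntegral Ω (doubleLayerErrorIntegrand Ω δ f y)| ≤ C * δ ^ 3 := by
  refine (isCompact_frontier hΩ).induction_on (p := fun T => ∃ C : ℝ, ∀ δ : ℝ, 0 < δ → ∀ y ∈ T,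
      |surfaceIntegral Ω (normalSumErrorIntegrand Ω δ f y)| ≤ C * δ ^ 3 ∧
      |surfaceIntegral Ω (doubleLayerErrorIntegrand Ω δ f y)| ≤ C * δ ^ 3) ?_ ?_ ?_ ?_
  · exact ⟨0, fun _ _ _ hy => absurd hy (notMem_empty _)⟩
  · rintro s t hst ⟨C, hC⟩
    exact ⟨C, fun δ hδ y hy => hC δ hδ y (hst hy)⟩
  · rintro s t ⟨C, hC⟩ ⟨C', hC'⟩
    refine ⟨max C C', fun δ hδ y hy => ?_⟩
    have l1 : C * δ ^ 3 ≤ max C C' * δ ^ 3 := by gcongr; exact le_max_left _ _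
    have l2 : C' * δ ^ 3 ≤ max C C' * δ ^ 3 := by gcongr; exact le_max_right _ _
    rcases hy with hy | hy
    · exact ⟨(hC δ hδ y hy).1.trans l1, (hC δ hδ y hy).2.trans l1⟩
    · exact ⟨(hC' δ hδ y hy).1.trans l2, (hC' δ hδ y hy).2.trans l2⟩
  · intro p hp
    obtain ⟨r, hr, C, hC⟩ := exists_local_error_bound hΩ hf hp
    exact ⟨_, inter_mem_nhdsWithin _ (Metric.ball_mem_nhds p hr), C, hC⟩

end Estimate

end ADL

theorem mainTheorem2 :
    -- replacing `G` by `G_δ` multiplies the gradient of `G` by the shape factor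
    (∀ z : E3, z ≠ 0 →
      HasGradientAt green ((1 / (4 * Real.pi * ‖z‖ ^ 3)) • z) z ∧
      ∀ δ : ℝ, 0 < δ → HasGradientAt (greenReg δ) (shapeFactor (‖z‖ / δ) • ∇ green z) z) ∧
    -- the regularization error on the surface is third order
    ∀ (Ω : Set E3), IsBoundedSmoothDomain Ω →
    ∀ (f : E3 → ℝ), ContDiffOn ℝ 2 f (frontier Ω) →
      (∀ y ∈ frontier Ω, SurfaceIntegrable Ω (modifiedIntegrand Ω f y) ∧
        ∀ δ : ℝ, 0 < δ →
          SurfaceIntegrable Ω (regularizedIntegrand Ω δ f y) ∧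
          SurfaceIntegrable Ω (normalSumErrorIntegrand Ω δ f y) ∧
          SurfaceIntegrable Ω (doubleLayerErrorIntegrand Ω δ f y)) ∧
      ∃ C : ℝ, ∀ δ : ℝ, 0 < δ → ∀ y ∈ frontier Ω,
        |surfaceIntegral Ω (normalSumErrorIntegrand Ω δ f y)| ≤ C * δ ^ 3 ∧
        |surfaceIntegral Ω (doubleLayerErrorIntegrand Ω δ f y)| ≤ C * δ ^ 3 ∧
        |regularizedADL Ω δ f y - modifiedADL Ω f y| ≤ C * δ ^ 3 := by
  refine ⟨fun z hz => ⟨hasGradientAt_green hz, fun δ hδ => hasGradientAt_greenReg hz hδ⟩,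
    fun Ω hΩ f hf => ⟨fun y hy => ⟨surfaceIntegrable_modifiedIntegrand hΩ hf.continuousOn hy,
      fun δ hδ => ⟨surfaceIntegrable_regularizedIntegrand hΩ hf.continuousOn hδ hy,
        surfaceIntegrable_normalSumErrorIntegrand hΩ hf.continuousOn hδ hy,
        surfaceIntegrable_doubleLayerErrorIntegrand hΩ hf.continuousOn hδ hy⟩⟩, ?_⟩⟩
  obtain ⟨C, hC⟩ := exists_error_bound hΩ hf
  -- The factor 2 accounts for `η - ε`. The sign of `C` is not known beforehand; `h3` supplies `0 ≤
  -- C * δ ^ 3`.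
  refine ⟨2 * C, fun δ hδ y hy => ?_⟩
  obtain ⟨h1, h2⟩ := hC δ hδ y hy
  have h3 := (abs_nonneg _).trans h1
  refine ⟨by linarith, by linarith, ?_⟩
  rw [regularizedADL_sub_modifiedADL hΩ hf.continuousOn hδ hy]
  refine (abs_sub _ _).trans ?_
  linarith
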